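/- Let $k$ be a perfect field and let $n, s$ be integers with $0 \le s \le n-2$. Let $f \in k[T_0,\ldots,T_n]$ be a non-zero homogeneous polynomial, and let $V(f) = \operatorname{Proj}\bigl(k[T_0,\ldots,T_n]/(f)\bigr) \subseteq \mathbb{P}^n_k$ be the hypersurface it defines. Suppose that the singular locus of $V(f)$, that is, the set of points of $V(f)$ at which the local ring is not regular, has dimension $s$. Write $$f(T_0+S_0,\ldots,T_n+S_n) = \sum_{I \in \mathbb{N}^{n+1}} f^I(T_0,\ldots,T_n)\, S_0^{i_0}\cdots S_n^{i_n},$$ and let $\mathcal{T}^1(f)$ be the $k$-vector space spanned by the first-order Hasse derivatives $f^I$, $|I| = i_0+\cdots+i_n = 1$ (that is, by the partial derivatives $\partial f/\partial T_0,\ldots,\partial f/\partial T_n$). Then there exist a finite field extension $k'/k$ and non-zero polynomials $g_1,\ldots,g_{n-s-1} \in \mathcal{T}^1(f)\otimes_k k' \subseteq k'[T_0,\ldots,T_n]$ such that $$\dim\bigl(V(f)_{k'} \cap V(g_1) \cap \cdots \cap V(g_{n-s-1})\bigr) = s,$$ where the intersection is taken in $\mathbb{P}^n_{k'}$. In other words,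 this scheme is a complete intersection: it is cut out by $n-s$ hypersurfaces, and all its irreducible components have dimension $s = n-(n-s)$. -/

import Mathlib

open AlgebraicGeometry

universe u

namespace ProjHypersurface

noncomputable section QuotientGrading

/-! ### The grading of a quotient of a graded algebra by a homogeneous ideal -/

open DirectSum

variable {k A : Type u} [Field k] [CommRing A] [Algebra k A] (𝒜 : ℕ → Submodule k A)

/-- The degree `d` piece of `A ⧸ I`: the image of the degree `d` piece of `A`. -/
def quotientGrading (I : Ideal A) (d : ℕ) : Submodule k (A ⧸ I) :=
  (𝒜 d).map (Ideal.Quotient.mkₐ k I).toLinearMap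

/-- The projection `𝒜 d → (A ⧸ I)_d`. -/
def quotientPiece (I : Ideal A) (d : ℕ) : 𝒜 d →ₗ[k] quotientGrading 𝒜 I d :=
  (Ideal.Quotient.mkₐ k I).toLinearMap.submoduleMap (𝒜 d)

variable [GradedAlgebra 𝒜]

/-- The map `A → ⨁ (A ⧸ I)_d` sending `a` to the classes of its homogeneous components. -/
def quotientDecomposeAux (I : Ideal A) : A →ₗ[k] ⨁ d, quotientGrading 𝒜 I d :=
  (DirectSum.lmap (quotientPiece 𝒜 I)).comp (decomposeLinearEquiv 𝒜).toLinearMap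

lemma quotientDecomposeAux_apply (I : Ideal A) (a : A) (d : ℕ) :
    ((quotientDecomposeAux 𝒜 I a d : quotientGrading 𝒜 I d) : A ⧸ I) =
      Ideal.Quotient.mk I (decompose 𝒜 a d) := by
  simp [quotientDecomposeAux, DirectSum.lmap]
  rfl

lemma quotientDecomposeAux_of_mem (I : Ideal A) {d : ℕ} {a : A} (ha : a ∈ 𝒜 d) :
    quotientDecomposeAux 𝒜 I a =
      DirectSum.of (fun d => quotientGrading 𝒜 I d) d (quotientPiece 𝒜 I d ⟨a, ha⟩) := by
  simp only [quotientDecomposeAux, LinearMap.comp_apply, LinearEquiv.coe_coe,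
    decomposeLinearEquiv_apply, decompose_of_mem 𝒜 ha, DirectSum.lmap_of]

lemma quotientDecomposeAux_eq_zero (I : HomogeneousIdeal 𝒜) {a : A} (ha : a ∈ I.toIdeal) :
    quotientDecomposeAux 𝒜 I.toIdeal a = 0 := by
  refine DFinsupp.ext fun d => Subtype.ext ?_
  exact (quotientDecomposeAux_apply 𝒜 I.toIdeal a d).trans
    (Ideal.Quotient.eq_zero_iff_mem.mpr (I.isHomogeneous d ha))

/-- The decomposition of `A ⧸ I` into the classes of homogeneous components. -/
def quotientDecompose (I : HomogeneousIdeal 𝒜) :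
    (A ⧸ I.toIdeal) →ₗ[k] ⨁ d, quotientGrading 𝒜 I.toIdeal d :=
  { QuotientAddGroup.lift I.toIdeal.toAddSubgroup (quotientDecomposeAux 𝒜 I.toIdeal).toAddMonoidHom
      fun _ ha => quotientDecomposeAux_eq_zero 𝒜 I ha with
    map_smul' := by
      intro c x
      obtain ⟨a, rfl⟩ := Ideal.Quotient.mk_surjective x
      exact (quotientDecomposeAux 𝒜 I.toIdeal).map_smul c a }

lemma quotientDecompose_mk (I : HomogeneousIdeal 𝒜) (a : A) :
    quotientDecompose 𝒜 I (Ideal.Quotient.mk I.toIdeal a) = quotientDecomposeAux 𝒜 I.toIdeal a :=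
  rfl

instance quotientGradedMonoid (I : Ideal A) : SetLike.GradedMonoid (quotientGrading 𝒜 I) where
  one_mem := ⟨1, SetLike.GradedOne.one_mem, map_one (Ideal.Quotient.mkₐ k I)⟩
  mul_mem := by
    rintro i j _ _ ⟨a, ha, rfl⟩ ⟨b, hb, rfl⟩
    exact ⟨a * b, SetLike.GradedMul.mul_mem ha hb, map_mul (Ideal.Quotient.mkₐ k I) a b⟩

instance quotientGradedAlgebra (I : HomogeneousIdeal 𝒜) :
    GradedAlgebra (quotientGrading 𝒜 I.toIdeal) where
  toDecomposition := Decomposition.ofLinearMap _ (quotientDecompose 𝒜 I)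
    (by
      refine LinearMap.ext fun x => ?_
      obtain ⟨a, rfl⟩ := Ideal.Quotient.mk_surjective x
      simp only [LinearMap.comp_apply, LinearMap.id_apply, quotientDecompose_mk]
      induction a using Decomposition.inductionOn 𝒜 with
      | zero => simp
      | homogeneous a =>
        rw [quotientDecomposeAux_of_mem 𝒜 I.toIdeal a.2]
        exact DirectSum.coeLinearMap_of _ _ _
      | add a b ha hb => rw [map_add, map_add, map_add, ha, hb])
    (by
      refine DirectSum.linearMap_ext _ fun d => LinearMap.ext ?_
      rintro ⟨_, a, ha, rfl⟩
      simp only [LinearMap.comp_apply, LinearMap.id_apply, DirectSum.coeLinearMap_lof]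
      exact (quotientDecompose_mk 𝒜 I a).trans
        (quotientDecomposeAux_of_mem 𝒜 I.toIdeal ha))

end QuotientGrading

noncomputable section Projective

/-! ### Closed subschemes of projective space cut out by homogeneous polynomials -/

attribute [local instance] MvPolynomial.gradedAlgebra

variable {n : ℕ} {k : Type u} [Field k]

/-- The smallest homogeneous ideal of `k[T₀, …, Tₙ]` containing `S`. If `S` consists of
homogeneous polynomials, this is the ideal generated by `S`; see `toIdeal_homogeneousIdeal`. -/
def homogeneousIdeal (S : Set (MvPolynomial (Fin (n + 1)) k)) :
    HomogeneousIdeal (MvPolynomial.homogeneousSubmodule (Fin (n + 1)) k) :=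
  (Ideal.span S).homogeneousHull _

lemma toIdeal_homogeneousIdeal {S : Set (MvPolynomial (Fin (n + 1)) k)}
    (hS : ∀ p ∈ S, ∃ d, p.IsHomogeneous d) : (homogeneousIdeal S).toIdeal = Ideal.span S :=
  (Ideal.homogeneous_span _ S fun p hp => (hS p hp).imp fun _ h => h).toIdeal_homogeneousHull_eq_self

/-- The closed subscheme `Proj (k[T₀, …, Tₙ] ⧸ (S))` of `ℙⁿ` over `k` cut out by a set `S` of
homogeneous polynomials. It is the scheme-theoretic intersection of the `V(p)`, `p ∈ S`. -/
def V (S : Set (MvPolynomial (Fin (n + 1)) k)) : Scheme.{u} :=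
  Proj (quotientGrading (MvPolynomial.homogeneousSubmodule (Fin (n + 1)) k)
    (homogeneousIdeal S).toIdeal)

end Projective

/-- The singular locus of a scheme: the points whose local ring is not a regular local ring. -/
def singularLocus (X : Scheme.{u}) : Set X :=
  {x | ¬ IsRegularLocalRing (X.presheaf.stalk x)}

noncomputable section Derivatives

/-! ### Hasse derivatives -/

variable {n : ℕ} {k : Type u} [Field k]

/-- The Hasse derivative `g^I`: the coefficient of `S^I` in the expansion of
`g(T₀ + S₀, …, Tₙ + Sₙ)` as a polynomial in the `S_i` with coefficients in `k[T₀, …, Tₙ]`. -/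
def hasseDeriv (I : Fin (n + 1) →₀ ℕ) (g : MvPolynomial (Fin (n + 1)) k) :
    MvPolynomial (Fin (n + 1)) k :=
  MvPolynomial.coeff I
    (MvPolynomial.aeval (fun i => MvPolynomial.C (MvPolynomial.X i) + MvPolynomial.X i) g :
      MvPolynomial (Fin (n + 1)) (MvPolynomial (Fin (n + 1)) k))

/-- The `k`-vector space `𝒯^α(g)` spanned by the Hasse derivatives of `g` of order `α`. -/
def derivSpace (α : ℕ) (g : MvPolynomial (Fin (n + 1)) k) :
    Submodule k (MvPolynomial (Fin (n + 1)) k) :=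
  Submodule.span k {h | ∃ I : Fin (n + 1) →₀ ℕ, I.degree = α ∧ h = hasseDeriv I g}

/-- The extension of scalars `𝒯^α(g) ⊗ₖ k'`, as a `k'`-subspace of `k'[T₀, …, Tₙ]`. -/
def derivSpaceBaseChange (k' : Type u) [Field k'] [Algebra k k'] (α : ℕ)
    (g : MvPolynomial (Fin (n + 1)) k) : Submodule k' (MvPolynomial (Fin (n + 1)) k') :=
  Submodule.span k' (MvPolynomial.map (algebraMap k k') '' (derivSpace α g : Set _))

end Derivatives

end ProjHypersurface

/-! ### Heights and forms in polynomial rings -/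

section PolynomialRing

open MvPolynomial

/-! Let K be an algebraic closure of k and W the K-span of the partial derivatives of f. The forms
are generic elements of W, chosen one at a time: an element of W that avoids the finitely many
minimal primes of (f, g_1, …, g_j) not containing W raises the height of everything outside the zero
locus of W (`exists_forall_le_or_le_height`). In the end a prime containing f and all g_j contains
every partial derivative or has height at least n - s. The g_j involve finitely many coefficients,
and this dichotomy descends by lying over to the finite extension k' that they generate
(`exists_finiteDimensional_forms`).

Upper bound: consider the first prime of a chain in the intersection. If its height is at least n -
s, the chain has length at most s (`height_add_length_le`). Otherwise the chain lies in the common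
zeros of f and its partial derivatives. Their dimension does not grow from k to k', and over k they
are singular points of V(f). Only this half of the Jacobian criterion is needed, and it is where
perfectness enters: residue fields are formally smooth over k, so the conormal map is injective, and
vanishing of df puts f in the square of the maximal ideal (`exists_mul_mem_sq_of_pderiv_mem`).
Dividing by such a nonzerodivisor lowers the dimension but not the embedding dimension
(`not_isRegularLocalRing_of_ker_le_sq`).

Lower bound: by Krull's height theorem every component has dimension at least n - (n - s) = s
(`exists_ltSeries_of_mem_minimalPrimes`), and n - s ≤ n forms of positive degree have a common zero.
The g_j have positive degree because f has degree at least 2: hypersurfaces of degree 0 or 1 are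
empty or regular. Moreover W ≠ 0, since otherwise all of V(f), of dimension at least n - 1 > s,
would be singular.

Dimensions are computed as lengths of chains of homogeneous primes, and the local rings of Proj are
studied through the map from the degree zero part A_(P) to A_P. -/

lemma MvPolynomial.height_eq_of_isMaximal {k : Type*} [Field k] :
    ∀ (n : ℕ) (M : Ideal (MvPolynomial (Fin n) k)) [M.IsMaximal], M.height = n
  | 0, M, hM => by
    have h0 : ringKrullDim (MvPolynomial (Fin 0) k) = 0 := by simp
    have := Ideal.height_le_ringKrullDim_of_ne_top hM.ne_top
    rw [h0] at this
    have h : M.height ≤ 0 := by exact_mod_cast this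
    simpa using h
  | n + 1, M, hM => by
    let e := (finSuccEquiv k n).toRingEquiv
    have hmax : (M.comap e.symm).IsMaximal := Ideal.comap_isMaximal_of_equiv e.symm
    -- Fields are Jacobson rings, so the contraction to one variable fewer is again maximal; a
    -- maximal ideal of R[X] has height one more than its contraction.
    have hc : ((M.comap e.symm).comap Polynomial.C).IsMaximal :=
      Polynomial.isMaximal_comap_C_of_isJacobsonRing _
    have : (M.comap e.symm).LiesOver ((M.comap e.symm).comap Polynomial.C) := ⟨rfl⟩
    have := Polynomial.height_eq_height_add_one ((M.comap e.symm).comap Polynomial.C)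
      (M.comap e.symm)
    rw [RingEquiv.height_comap, MvPolynomial.height_eq_of_isMaximal n] at this
    rw [this]; simp

variable {σ k : Type*} [Field k]

/-- A form is multiplied by `r ^ d` when its arguments are multiplied by `r`. -/
lemma MvPolynomial.aeval_mul_of_isHomogeneous {L : Type*} [CommRing L] [Algebra k L]
    {a : MvPolynomial σ k} {d : ℕ} (ha : a.IsHomogeneous d) (r : L) (x : σ → L) :
    aeval (fun j => r * x j) a = r ^ d * aeval x a := by
  classical
  rw [aeval_def, aeval_def, eval₂_eq, eval₂_eq, Finset.mul_sum]
  refine Finset.sum_congr rfl fun m hm => ?_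
  simp_rw [mul_pow, Finset.prod_mul_distrib, Finset.prod_pow_eq_pow_sum]
  have : ∑ i ∈ m.support, m i = d := by
    rw [← ha.degree_eq_sum_deg_support hm]
  rw [this]; ring

end PolynomialRing

/-! ### Homogeneous ideals and dehomogenization at a form of degree one -/

section Graded

variable {A σ : Type*} [CommRing A] [SetLike σ A] [AddSubgroupClass σ A] (𝒜 : ℕ → σ) [GradedRing 𝒜]

/-- Modulo t - 1 the powers of t are 1, so multiplying by them brings all components to a common
degree. -/
lemma exists_homogeneous_sub_mem_span {t : A} (ht : t ∈ 𝒜 1) (x : A) :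
    ∃ (N : ℕ) (y : A), y ∈ 𝒜 N ∧ x - y ∈ Ideal.span {t - 1} := by
  have hpow : ∀ N : ℕ, t ^ N - 1 ∈ Ideal.span {t - 1} := fun N =>
    Ideal.mem_span_singleton.mpr (sub_one_dvd_pow_sub_one t N)
  have htN : ∀ N : ℕ, t ^ N ∈ 𝒜 N := fun N => by
    simpa using SetLike.pow_mem_graded N ht
  induction x using DirectSum.Decomposition.inductionOn 𝒜 with
  | zero => exact ⟨0, 0, zero_mem _, by simp⟩
  | @homogeneous i m => exact ⟨i, m, m.2, by simp⟩
  | add a b iha ihb =>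
    obtain ⟨N, y, hy, hay⟩ := iha
    obtain ⟨N', y', hy', hby⟩ := ihb
    refine ⟨N + N', y * t ^ N' + t ^ N * y', add_mem (SetLike.mul_mem_graded hy (htN _))
      (SetLike.mul_mem_graded (htN _) hy'), ?_⟩
    have : a + b - (y * t ^ N' + t ^ N * y') =
        (a - y) + (b - y') - y * (t ^ N' - 1) - y' * (t ^ N - 1) := by ring
    rw [this]
    exact sub_mem (sub_mem (add_mem hay hby) (Ideal.mul_mem_left _ _ (hpow _)))
      (Ideal.mul_mem_left _ _ (hpow _))

/-- Modulo t - 1 an element separating q from q' can be replaced by a form, and forms are seen by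
the cores. This carries chains from an affine chart to projective space. -/
lemma homogeneousCore_lt_of_lt {t : A} (ht : t ∈ 𝒜 1) {q q' : Ideal A} (hq : t - 1 ∈ q)
    (h : q < q') : q.homogeneousCore 𝒜 < q'.homogeneousCore 𝒜 := by
  refine lt_of_le_not_ge (Ideal.homogeneousCore_mono 𝒜 h.le) fun hle => ?_
  obtain ⟨x, hx', hx⟩ := SetLike.exists_of_lt h
  obtain ⟨N, y, hy, hxy⟩ := exists_homogeneous_sub_mem_span 𝒜 ht x
  have hs : ∀ {r : Ideal A}, t - 1 ∈ r → (x ∈ r ↔ y ∈ r) := fun {r} hr => by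
    have := (Ideal.span_singleton_le_iff_mem r).mpr hr hxy
    exact ⟨fun h => by simpa using sub_mem h this, fun h => by simpa using add_mem this h⟩
  have hy' : y ∈ q'.homogeneousCore 𝒜 :=
    Ideal.mem_homogeneousCore_of_homogeneous_of_mem ⟨N, hy⟩ ((hs (h.le hq)).mp hx')
  exact hx ((hs hq).mpr (Ideal.toIdeal_homogeneousCore_le 𝒜 q (hle hy')))

/-- The homogeneous core of P is a prime between I and P, so minimality makes it equal to P. -/
lemma Ideal.IsHomogeneous.of_mem_minimalPrimes {I P : Ideal A} (hI : I.IsHomogeneous 𝒜)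
    (hP : P ∈ I.minimalPrimes) : P.IsHomogeneous 𝒜 := by
  have hprime : (P.homogeneousCore 𝒜).toIdeal.IsPrime := Ideal.IsPrime.homogeneousCore hP.1.1
  have hle : I ≤ (P.homogeneousCore 𝒜).toIdeal := by
    rw [← hI.toIdeal_homogeneousCore_eq_self]
    exact Ideal.homogeneousCore_mono 𝒜 hP.1.2
  have := le_antisymm (hP.2 ⟨hprime, hle⟩ (Ideal.toIdeal_homogeneousCore_le 𝒜 P))
    (Ideal.toIdeal_homogeneousCore_le 𝒜 P)
  rw [this]
  exact (P.homogeneousCore 𝒜).isHomogeneous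

/-- A homogeneous ideal not contained in an ideal has a homogeneous element outside of it. -/
lemma Ideal.IsHomogeneous.exists_homogeneous_notMem {I P : Ideal A} (hI : I.IsHomogeneous 𝒜)
    (h : ¬ I ≤ P) : ∃ d, ∃ a ∈ 𝒜 d, a ∈ I ∧ a ∉ P := by
  classical
  contrapose! h
  intro x hx
  rw [← DirectSum.sum_support_decompose 𝒜 x]
  exact Ideal.sum_mem _ fun d _ => h d _ (SetLike.coe_mem _) (hI d hx)

end Graded

/-! ### Krull's height theorem for closed subsets of projective space -/

section Chains

open MvPolynomial

attribute [local instance] MvPolynomial.gradedAlgebra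

variable {n : ℕ} {k : Type u} [Field k]

/-- The prime ideal of the affine chart `X i = 1` that corresponds to a homogeneous prime ideal. -/
lemma exists_prime_dehomogenization {P : Ideal (MvPolynomial (Fin (n + 1)) k)} [P.IsPrime]
    (hP : P.IsHomogeneous (homogeneousSubmodule (Fin (n + 1)) k)) {i : Fin (n + 1)}
    (hi : X i ∉ P) :
    ∃ Q : Ideal (MvPolynomial (Fin (n + 1)) k), Q.IsPrime ∧ P ≤ Q ∧ X i - 1 ∈ Q ∧
      ∀ d a, a.IsHomogeneous d → a ∈ Q → a ∈ P := by
  classical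
  let L := FractionRing (MvPolynomial (Fin (n + 1)) k ⧸ P)
  let ι : MvPolynomial (Fin (n + 1)) k →ₐ[k] L :=
    (IsScalarTower.toAlgHom k (MvPolynomial (Fin (n + 1)) k ⧸ P) L).comp (Ideal.Quotient.mkₐ k P)
  have hι : ∀ a, ι a = 0 ↔ a ∈ P := fun a => by
    rw [← Ideal.Quotient.eq_zero_iff_mem]
    exact (injective_iff_map_eq_zero' (algebraMap (MvPolynomial (Fin (n + 1)) k ⧸ P) L)).mp
      (IsFractionRing.injective _ _) _
  have ht : ι (X i) ≠ 0 := fun h => hi ((hι _).mp h)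
  -- Evaluation at the generic point, normalized to have i-th coordinate 1. On forms it differs from
  -- `ι` by a power of the unit `ι (X i)`, and Q is its kernel.
  let φ : MvPolynomial (Fin (n + 1)) k →ₐ[k] L := aeval fun j => ι (X j) / ι (X i)
  have hφ : ∀ d a, a.IsHomogeneous d → ι (X i) ^ d * φ a = ι a := fun d a ha => by
    rw [← aeval_mul_of_isHomogeneous ha]
    have : (fun j => ι (X i) * (ι (X j) / ι (X i))) = fun j => ι (X j) := by
      funext j; exact mul_div_cancel₀ _ ht
    rw [this]; exact (DFunLike.congr_fun (MvPolynomial.aeval_unique ι) a).symm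
  have hφ' : ∀ d a, a.IsHomogeneous d → (φ a = 0 ↔ a ∈ P) := fun d a ha => by
    rw [← hι, ← hφ d a ha, mul_eq_zero, or_iff_right (pow_ne_zero _ ht)]
  refine ⟨RingHom.ker φ, RingHom.ker_isPrime _, fun p hp => ?_, ?_, fun d a ha h =>
    (hφ' d a ha).mp h⟩
  · rw [RingHom.mem_ker, ← DirectSum.sum_support_decompose (homogeneousSubmodule (Fin (n + 1)) k) p,
      map_sum]
    exact Finset.sum_eq_zero fun d _ => (hφ' d _ ((mem_homogeneousSubmodule d _).mp
      (SetLike.coe_mem _))).mpr (hP d hp)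
  · rw [RingHom.mem_ker, map_sub, map_one, aeval_X, div_self ht, sub_self]

/-- A component of a closed subset of projective space that is defined by `r` forms contains a
chain of at least `n - r` specializations. -/
theorem exists_ltSeries_of_mem_minimalPrimes {S : Set (MvPolynomial (Fin (n + 1)) k)} {r : ℕ}
    (hS : S.encard ≤ r) (hhom : (Ideal.span S).IsHomogeneous (homogeneousSubmodule (Fin (n + 1)) k))
    {P : Ideal (MvPolynomial (Fin (n + 1)) k)} (hP : P ∈ (Ideal.span S).minimalPrimes)
    {i : Fin (n + 1)} (hi : X i ∉ P) :
    ∃ l : LTSeries (ProjectiveSpectrum (homogeneousSubmodule (Fin (n + 1)) k)),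
      n ≤ l.length + r ∧ P ≤ l.head.asHomogeneousIdeal.toIdeal := by
  classical
  set 𝒜 := homogeneousSubmodule (Fin (n + 1)) k
  have := hP.1.1
  have hPh := hhom.of_mem_minimalPrimes 𝒜 hP
  obtain ⟨Q, hQ, hPQ, hiQ, hQP⟩ := exists_prime_dehomogenization hPh hi
  have hfin := (Ideal.span S).finite_minimalPrimes_of_isNoetherianRing
  -- The product u of these forms vanishes on every component other than that of P, but not at P;
  -- for P' = P the harmless factor 1 is used.
  have hsep : ∀ P' ∈ (Ideal.span S).minimalPrimes, ∃ d, ∃ a ∈ 𝒜 d, (P' ≠ P → a ∈ P') ∧ a ∉ P := by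
    intro P' hP'
    by_cases h : P' = P
    · exact ⟨0, 1, SetLike.GradedOne.one_mem, fun h' => absurd h h',
        (Ideal.ne_top_iff_one _).mp hP.1.1.ne_top⟩
    · obtain ⟨d, a, ha, haP', haP⟩ := (hhom.of_mem_minimalPrimes 𝒜 hP').exists_homogeneous_notMem 𝒜
        (P := P) fun hle => h (le_antisymm hle (hP.2 hP'.1 hle))
      exact ⟨d, a, ha, fun _ => haP', haP⟩
  choose! d a had haP' haP using hsep
  set u := ∏ P' ∈ hfin.toFinset, a P'
  have huh : u.IsHomogeneous (∑ P' ∈ hfin.toFinset, d P') :=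
    IsHomogeneous.prod _ _ _ fun P' h => had P' (hfin.mem_toFinset.mp h)
  have huP : u ∉ P := fun h => by
    obtain ⟨P', h', h''⟩ := (Ideal.IsPrime.prod_mem_iff).mp h
    exact haP P' (hfin.mem_toFinset.mp h') h''
  have huQ : u ∉ Q := fun h => huP (hQP _ _ huh h)
  -- A closed point of the chart that lies on the component of P and on no other.
  obtain ⟨M, hQM, hM, huM⟩ : ∃ M : Ideal _, Q ≤ M ∧ M.IsMaximal ∧ u ∉ M := by
    have hj : Q.jacobson = Q := IsJacobsonRing.out' Q hQ.isRadical
    rw [← hj, Ideal.jacobson, Submodule.mem_sInf] at huQ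
    push Not at huQ
    obtain ⟨M, ⟨h1, h2⟩, h3⟩ := huQ
    exact ⟨M, h1, h2, h3⟩
  set T := insert (X i - 1) S
  have hTM : T ⊆ M := by
    rintro x (rfl | hx)
    · exact hQM hiQ
    · exact hQM (hPQ (hP.1.2 (Ideal.subset_span hx)))
  have hTr : T.encard ≤ r + 1 := (Set.encard_insert_le _ _).trans (by gcongr)
  set J := Ideal.span T
  have hJM : J ≤ M := Ideal.span_le.mpr hTM
  have hMh := Ideal.height_le_height_add_encard_of_subset T hTM
  have hM' : (M.map (Ideal.Quotient.mk J)).IsPrime := Ideal.isPrime_map_quotientMk_of_isPrime hJM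
  obtain ⟨l, hlast, hlen⟩ := Ideal.exists_ltSeries_length_eq_height (M.map (Ideal.Quotient.mk J))
  -- M has height n + 1, and dividing by the r + 1 generators `X i - 1` and S lowers it by at most r
  -- + 1.
  have hlen' : n ≤ l.length + r := by
    rw [MvPolynomial.height_eq_of_isMaximal, ← hlen] at hMh
    have : ((n + 1 : ℕ) : ℕ∞) ≤ ((l.length + (r + 1) : ℕ) : ℕ∞) := by
      refine hMh.trans ?_
      push_cast
      gcongr
    have := ENat.natCast_le_natCast.mp this
    omega
  let q : Fin (l.length + 1) → Ideal (MvPolynomial (Fin (n + 1)) k) := fun j =>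
    (l j).asIdeal.comap (Ideal.Quotient.mk J)
  have hq : ∀ j, (q j).IsPrime := fun j => Ideal.comap_isPrime _ _
  have hJq : ∀ j, J ≤ q j := fun j x hx => by
    simp only [q, Ideal.mem_comap, Ideal.Quotient.eq_zero_iff_mem.mpr hx, zero_mem]
  have hqM : ∀ j, q j ≤ M := fun j => by
    have h1 : l j ≤ l.last := LTSeries.monotone l (Fin.le_last j)
    rw [hlast] at h1
    refine (Ideal.comap_mono h1).trans ?_
    change Ideal.comap _ (Ideal.map _ M) ≤ M
    rw [Ideal.comap_map_of_surjective _ Ideal.Quotient.mk_surjective, ← RingHom.ker_eq_comap_bot,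
      Ideal.mk_ker, sup_of_le_left hJM]
  have hiq : ∀ j, X i - 1 ∈ q j := fun j => hJq j (Ideal.subset_span (Set.mem_insert _ _))
  have hXq : ∀ j, X i ∉ q j := fun j h => (Ideal.ne_top_iff_one _).mp (hq j).ne_top
    (by simpa using sub_mem h (hiq j))
  -- A minimal prime below `q j` other than P would contain a factor of u, forcing u into M.
  have hPq : ∀ j, P ≤ q j := fun j => by
    obtain ⟨P', hP', hle⟩ := Ideal.exists_minimalPrimes_le
      ((Ideal.span_mono (Set.subset_insert _ _)).trans (hJq j))
    by_cases h : P' = P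
    · exact h ▸ hle
    · exact absurd (Ideal.mem_of_dvd M (Finset.dvd_prod_of_mem a (hfin.mem_toFinset.mpr hP'))
        (hqM j (hle (haP' P' hP' h)))) huM
  have hlt : ∀ j : Fin l.length, q j.castSucc < q j.succ := fun j => by
    have h1 := l.step j
    refine lt_of_le_not_ge (Ideal.comap_mono h1.le) fun h => ?_
    exact absurd ((Ideal.comap_le_comap_iff_of_surjective _ Ideal.Quotient.mk_surjective _ _).mp h)
      (not_le_of_gt h1)
  refine ⟨⟨l.length, fun j => ⟨(q j).homogeneousCore 𝒜, Ideal.IsPrime.homogeneousCore (hq j),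
    fun h => hXq j (Ideal.toIdeal_homogeneousCore_le 𝒜 _
      (h (HomogeneousIdeal.mem_irrelevant_of_mem 𝒜 zero_lt_one (isHomogeneous_X k i))))⟩,
    fun j => homogeneousCore_lt_of_lt 𝒜 (isHomogeneous_X k i) (hiq _) (hlt j)⟩, hlen', ?_⟩
  rw [← hPh.toIdeal_homogeneousCore_eq_self]
  exact Ideal.homogeneousCore_mono 𝒜 (hPq 0)

end Chains

/-! ### The Jacobian criterion over a perfect field -/

section Jacobian

open MvPolynomial TensorProduct

lemma Derivation.eq_sum_pderiv {σ k M : Type*} [Fintype σ] [CommRing k] [AddCommGroup M] [Module k M]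
    [Module (MvPolynomial σ k) M] [IsScalarTower k (MvPolynomial σ k) M]
    (D : Derivation k (MvPolynomial σ k) M) (f : MvPolynomial σ k) :
    D f = ∑ i, pderiv i f • D (X i) := by
  classical
  induction f using MvPolynomial.induction_on with
  | C a => simp [MvPolynomial.derivation_C]
  | add p q hp hq => simp [hp, hq, add_smul, Finset.sum_add_distrib]
  | mul_X p j hp =>
    simp [hp, Derivation.leibniz, add_smul, Finset.sum_add_distrib, pderiv_X, Pi.single_apply,
      mul_smul, Finset.smul_sum]

lemma KaehlerDifferential.D_algebraMap_eq_sum_pderiv {σ k R : Type*} [Fintype σ] [CommRing k]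
    [CommRing R] [Algebra k R] [Algebra (MvPolynomial σ k) R] [IsScalarTower k (MvPolynomial σ k) R]
    (f : MvPolynomial σ k) :
    KaehlerDifferential.D k R (algebraMap (MvPolynomial σ k) R f) =
      ∑ i, algebraMap (MvPolynomial σ k) R (pderiv i f) •
        KaehlerDifferential.D k R (algebraMap (MvPolynomial σ k) R (X i)) := by
  have := Derivation.eq_sum_pderiv ((KaehlerDifferential.D k R).compAlgebraMap (MvPolynomial σ k)) f
  exact this.trans (Finset.sum_congr rfl fun i _ => (algebraMap_smul R (pderiv i f) _).symm)

/-- The conormal map sends the class of x to 1 ⊗ Dx, which vanishes since every coefficient `c i`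
dies in κ. -/
lemma KaehlerDifferential.mem_sq_ker_of_D_eq_sum {k R κ ι : Type*} [CommRing k] [CommRing R]
    [CommRing κ] [Algebra k R] [Algebra k κ] [Algebra R κ] [IsScalarTower k R κ] [Fintype ι]
    (hinj : Function.Injective (KaehlerDifferential.kerCotangentToTensor k R κ)) {x : R}
    (hx : x ∈ RingHom.ker (algebraMap R κ)) (c : ι → R) (hc : ∀ i, algebraMap R κ (c i) = 0)
    (m : ι → Ω[R⁄k]) (h : KaehlerDifferential.D k R x = ∑ i, c i • m i) :
    x ∈ RingHom.ker (algebraMap R κ) ^ 2 := by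
  have hz : KaehlerDifferential.kerCotangentToTensor k R κ (Ideal.toCotangent _ ⟨x, hx⟩) = 0 := by
    rw [KaehlerDifferential.kerCotangentToTensor_toCotangent, h, TensorProduct.tmul_sum]
    refine Finset.sum_eq_zero fun i _ => ?_
    rw [← TensorProduct.smul_tmul, Algebra.smul_def, hc, zero_mul, TensorProduct.zero_tmul]
  exact (Ideal.toCotangent_eq_zero _ _).mp (hinj (hz.trans (map_zero _).symm))

/-- Over a perfect field, a polynomial that vanishes at a point together with its partial
derivatives lies in the square of the maximal ideal of the local ring at this point. -/
theorem exists_mul_mem_sq_of_pderiv_mem {σ k : Type*} [Finite σ] [Field k] [PerfectField k]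
    (P : Ideal (MvPolynomial σ k)) [P.IsPrime] {f : MvPolynomial σ k} (hf : f ∈ P)
    (hd : ∀ i, pderiv i f ∈ P) : ∃ u ∉ P, u * f ∈ P ^ 2 := by
  have := Fintype.ofFinite σ
  let R := Localization.AtPrime P
  let κ := IsLocalRing.ResidueField R
  have h1 : Algebra.FormallySmooth (MvPolynomial σ k) R :=
    Algebra.FormallySmooth.of_isLocalization P.primeCompl
  have h2 : Algebra.FormallySmooth k R := .comp k (MvPolynomial σ k) R
  have h3 : Algebra.EssFiniteType (MvPolynomial σ k) R :=
    Algebra.EssFiniteType.of_isLocalization R P.primeCompl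
  have h4 : Algebra.EssFiniteType k R := .comp k (MvPolynomial σ k) R
  have h5 : Algebra.EssFiniteType k κ := .comp k R κ
  -- The use of perfectness: it makes the conormal map of R → κ injective.
  have h6 : Algebra.FormallySmooth k κ := Algebra.FormallySmooth.of_perfectField
  have hsurj : Function.Surjective (algebraMap R κ) := IsLocalRing.residue_surjective
  have hinj : Function.Injective (KaehlerDifferential.kerCotangentToTensor k R κ) :=
    (Algebra.FormallySmooth.kerCotangentToTensor_injective_iff hsurj).mpr inferInstance
  have hmem : ∀ a ∈ P, algebraMap R κ (algebraMap (MvPolynomial σ k) R a) = 0 := fun a ha => by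
    have := (IsLocalization.AtPrime.to_map_mem_maximal_iff R P a).mpr ha
    exact (IsLocalRing.residue_eq_zero_iff _).mpr this
  have hker : RingHom.ker (algebraMap R κ) = IsLocalRing.maximalIdeal R := IsLocalRing.ker_residue
  have h0 := KaehlerDifferential.mem_sq_ker_of_D_eq_sum hinj (hmem f hf)
    (fun i => algebraMap (MvPolynomial σ k) R (pderiv i f)) (fun i => hmem _ (hd i)) _
    (KaehlerDifferential.D_algebraMap_eq_sum_pderiv f)
  rw [hker, ← Localization.AtPrime.map_eq_maximalIdeal,
    ← Ideal.map_pow] at h0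
  obtain ⟨u, hu, huf⟩ :=
    (IsLocalization.algebraMap_mem_map_algebraMap_iff P.primeCompl R (P ^ 2) f).mp h0
  exact ⟨u, hu, huf⟩

end Jacobian

/-! ### First-order Hasse derivatives as partial derivatives -/

namespace ProjHypersurface

open MvPolynomial

variable {n : ℕ} {k : Type u} [Field k]

lemma hasseDeriv_single (i : Fin (n + 1)) (g : MvPolynomial (Fin (n + 1)) k) :
    hasseDeriv (Finsupp.single i 1) g = pderiv i g := by
  classical
  let φ : MvPolynomial (Fin (n + 1)) k →ₐ[k] MvPolynomial (Fin (n + 1)) (MvPolynomial (Fin (n + 1)) k) :=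
    aeval fun i => C (X i) + X i
  -- Setting S = 0 in p(T + S) gives p; this supplies the undifferentiated factor in the Leibniz
  -- rule below.
  have h0 : ∀ p, coeff 0 (φ p) = p := fun p => by
    have : ((constantCoeff : MvPolynomial (Fin (n + 1)) (MvPolynomial (Fin (n + 1)) k) →+* _).comp
        φ.toRingHom) = RingHom.id _ := by
      refine MvPolynomial.ringHom_ext (fun a => ?_) fun j => ?_
      · simp [φ]
      · simp [φ]
    exact DFunLike.congr_fun this p
  change coeff (Finsupp.single i 1) (φ g) = _
  induction g using MvPolynomial.induction_on with
  | C a =>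
    rw [pderiv_C]
    have : φ (C a) = C (C a) := by simp [φ]
    rw [this, coeff_C, if_neg]
    exact fun h => by simpa using DFunLike.congr_fun h i
  | add p q hp hq => rw [map_add, coeff_add, hp, hq, map_add]
  | mul_X p j hp =>
    have : φ (X j) = C (X j) + X j := by simp [φ]
    rw [map_mul, this, mul_add, coeff_add, mul_comm _ (C (X j)), coeff_C_mul, hp, coeff_mul_X',
      pderiv_mul, pderiv_X]
    by_cases hij : j = i
    · subst hij
      simp [h0]
      ring
    · rw [if_neg (by simpa using hij)]
      simp [hij]
      ring

lemma derivSpace_one (g : MvPolynomial (Fin (n + 1)) k) :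
    derivSpace 1 g = Submodule.span k (Set.range fun i => pderiv i g) := by
  unfold derivSpace
  congr 1
  ext h
  constructor
  · rintro ⟨I, hI, rfl⟩
    obtain ⟨i, rfl⟩ := (Finsupp.sum_eq_one_iff I).mp hI
    exact ⟨i, (hasseDeriv_single i g).symm⟩
  · rintro ⟨i, rfl⟩
    exact ⟨Finsupp.single i 1, by simp, (hasseDeriv_single i g).symm⟩

lemma derivSpaceBaseChange_one (k' : Type u) [Field k'] [Algebra k k']
    (g : MvPolynomial (Fin (n + 1)) k) :
    derivSpaceBaseChange k' 1 g =
      Submodule.span k' (Set.range fun i => pderiv i (map (algebraMap k k') g)) := by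
  let φ : MvPolynomial (Fin (n + 1)) k →ₗ[k] MvPolynomial (Fin (n + 1)) k' :=
    (mapAlgHom (Algebra.ofId k k')).toLinearMap
  have h : MvPolynomial.map (algebraMap k k') '' (derivSpace 1 g : Set (MvPolynomial (Fin (n + 1)) k)) =
      ((Submodule.span k (Set.range fun i => pderiv i (map (algebraMap k k') g)) : Submodule k (MvPolynomial (Fin (n + 1)) k')) :
        Set (MvPolynomial (Fin (n + 1)) k')) := by
    have := Submodule.map_span φ (Set.range fun i => pderiv i g)
    rw [← Set.range_comp] at this
    rw [derivSpace_one]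
    refine Eq.trans ?_ ((congrArg (fun s : Submodule k _ => (s : Set _)) this).trans ?_)
    · rfl
    · simp only [pderiv_map]; rfl
  rw [derivSpaceBaseChange, h, Submodule.span_span_of_tower]

end ProjHypersurface

/-! ### The degree zero part of a localization compared with the whole localization -/

section HomogeneousLocalization

open HomogeneousLocalization IsLocalRing

variable {A σ : Type*} [CommRing A] [SetLike σ A] [AddSubgroupClass σ A] (𝒜 : ℕ → σ) [GradedRing 𝒜]
  (P : Ideal A) [P.IsPrime]

variable {t : A} (ht : t ∈ 𝒜 1) (htP : t ∉ P)

/-- The map `a ↦ a / t ^ d` on forms of degree `d`. -/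
noncomputable def dehomogenizeAux (d : ℕ) : 𝒜 d →+ HomogeneousLocalization.AtPrime 𝒜 P where
  toFun a := .mk ⟨d, a, ⟨t ^ d, by simpa using SetLike.pow_mem_graded d ht⟩,
    pow_mem (S := P.primeCompl) htP d⟩
  map_zero' := mk_eq_zero_of_num _ rfl
  map_add' a b := by
    rw [ext_iff_val, val_add, val_mk, val_mk, val_mk, Localization.add_mk_self]
    rfl

lemma val_dehomogenizeAux (d : ℕ) (a : 𝒜 d) : (dehomogenizeAux 𝒜 P ht htP d a).val =
    Localization.mk (a : A) ⟨t ^ d, pow_mem (S := P.primeCompl) htP d⟩ :=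
  val_mk _

/-- The ring homomorphism that sends a form `a` of degree `d` to `a / t ^ d`, for a fixed form `t`
of degree one. -/
noncomputable def dehomogenize : A →+* HomogeneousLocalization.AtPrime 𝒜 P :=
  (DirectSum.toSemiring (dehomogenizeAux 𝒜 P ht htP)
    (by
      rw [ext_iff_val, val_dehomogenizeAux, val_one, ← Localization.mk_one]
      congr 1
      exact Subtype.ext (pow_zero t))
    (fun {i j} a b => by
      rw [ext_iff_val, val_mul, val_dehomogenizeAux, val_dehomogenizeAux, val_dehomogenizeAux,
        Localization.mk_mul]
      congr 1
      exact Subtype.ext (pow_add t i j))).comp (DirectSum.decomposeRingEquiv 𝒜).toRingHom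

lemma val_dehomogenize {d : ℕ} {a : A} (ha : a ∈ 𝒜 d) : (dehomogenize 𝒜 P ht htP a).val =
    Localization.mk a ⟨t ^ d, pow_mem (S := P.primeCompl) htP d⟩ := by
  have : dehomogenize 𝒜 P ht htP a = dehomogenizeAux 𝒜 P ht htP d ⟨a, ha⟩ := by
    have h : (DirectSum.decomposeRingEquiv 𝒜).toRingHom a = DirectSum.of (fun i => 𝒜 i) d ⟨a, ha⟩ :=
      DirectSum.decompose_of_mem 𝒜 ha
    rw [dehomogenize, RingHom.comp_apply, h, DirectSum.toSemiring_of]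
  rw [this, val_dehomogenizeAux]

lemma isUnit_dehomogenize {d : ℕ} {a : A} (ha : a ∈ 𝒜 d) (haP : a ∉ P) :
    IsUnit (dehomogenize 𝒜 P ht htP a) := by
  rw [← isUnit_iff_isUnit_val, val_dehomogenize 𝒜 P ht htP ha, Localization.mk_eq_mk',
    IsLocalization.AtPrime.isUnit_mk'_iff (Localization.AtPrime P) P]
  exact haP

omit [AddSubgroupClass σ A] [GradedRing 𝒜] in
lemma HomogeneousLocalization.AtPrime.exists_val_eq_mk (x : HomogeneousLocalization.AtPrime 𝒜 P) :
    ∃ (d : ℕ) (a b : A) (_ : a ∈ 𝒜 d) (_ : b ∈ 𝒜 d) (hbP : b ∈ P.primeCompl),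
      x.val = Localization.mk a ⟨b, hbP⟩ := by
  obtain ⟨c, rfl⟩ := mk_surjective x
  exact ⟨c.deg, c.num, c.den, c.num.2, c.den.2, c.den_mem, val_mk c⟩

lemma mul_dehomogenize_eq {x : HomogeneousLocalization.AtPrime 𝒜 P} {d : ℕ} {a b : A} (ha : a ∈ 𝒜 d)
    (hb : b ∈ 𝒜 d) (hbP : b ∈ P.primeCompl) (hx : x.val = Localization.mk a ⟨b, hbP⟩) :
    x * dehomogenize 𝒜 P ht htP b = dehomogenize 𝒜 P ht htP a := by
  rw [ext_iff_val, val_mul, hx, val_dehomogenize 𝒜 P ht htP ha, val_dehomogenize 𝒜 P ht htP hb,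
    Localization.mk_mul, Localization.mk_eq_mk_iff, Localization.r_iff_exists]
  exact ⟨1, by simp; ring⟩

include ht htP

/-- An ideal of the degree zero part of a localization is generated by the classes of forms. -/
lemma map_comap_dehomogenize (I : Ideal (HomogeneousLocalization.AtPrime 𝒜 P)) :
    (I.comap (dehomogenize 𝒜 P ht htP)).map (dehomogenize 𝒜 P ht htP) = I := by
  refine le_antisymm Ideal.map_comap_le fun x hx => ?_
  obtain ⟨d, a, b, ha, hb, hbP, h⟩ := AtPrime.exists_val_eq_mk 𝒜 P x
  have h' := mul_dehomogenize_eq 𝒜 P ht htP ha hb hbP h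
  have hmem : dehomogenize 𝒜 P ht htP a ∈
      (I.comap (dehomogenize 𝒜 P ht htP)).map (dehomogenize 𝒜 P ht htP) :=
    Ideal.mem_map_of_mem _ (Ideal.mem_comap.mpr (h' ▸ I.mul_mem_right _ hx))
  rw [← h'] at hmem
  exact (Ideal.mul_unit_mem_iff_mem _ (isUnit_dehomogenize 𝒜 P ht htP hb hbP)).mp hmem

/-- Every ideal is extended from A along `dehomogenize`, and A is Noetherian. -/
theorem HomogeneousLocalization.AtPrime.isNoetherianRing [IsNoetherianRing A] :
    IsNoetherianRing (HomogeneousLocalization.AtPrime 𝒜 P) := by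
  refine (isNoetherianRing_iff_ideal_fg _).mpr fun I => ?_
  rw [← map_comap_dehomogenize 𝒜 P ht htP I]
  exact Ideal.FG.map (IsNoetherian.noetherian _) _

/-- Ideals of the degree zero part of a localization are contracted from the localization. -/
lemma mem_of_val_mem_map {I : Ideal (HomogeneousLocalization.AtPrime 𝒜 P)}
    {y : HomogeneousLocalization.AtPrime 𝒜 P}
    (hy : y.val ∈ I.map (algebraMap _ (Localization.AtPrime P))) : y ∈ I := by
  classical
  set N := ((I.comap (dehomogenize 𝒜 P ht htP)).homogeneousCore 𝒜).toIdeal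
  have hN : I.map (algebraMap _ (Localization.AtPrime P)) ≤
      N.map (algebraMap A (Localization.AtPrime P)) := by
    refine Ideal.map_le_iff_le_comap.mpr fun x hx => ?_
    obtain ⟨d, a, b, ha, hb, hbP, h⟩ := AtPrime.exists_val_eq_mk 𝒜 P x
    have h' := mul_dehomogenize_eq 𝒜 P ht htP ha hb hbP h
    rw [Ideal.mem_comap, HomogeneousLocalization.algebraMap_apply, h, Localization.mk_eq_mk',
      IsLocalization.mk'_mem_map_algebraMap_iff]
    exact ⟨1, P.primeCompl.one_mem, by
      rw [one_mul]
      exact Ideal.mem_homogeneousCore_of_homogeneous_of_mem ⟨d, ha⟩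
        (Ideal.mem_comap.mpr (h' ▸ I.mul_mem_right _ hx))⟩
  obtain ⟨d, a, b, ha, hb, hbP, h⟩ := AtPrime.exists_val_eq_mk 𝒜 P y
  have hy' := hN hy
  rw [h, Localization.mk_eq_mk', IsLocalization.mk'_mem_map_algebraMap_iff] at hy'
  obtain ⟨u, hu, hua⟩ := hy'
  -- The denominator u need not be homogeneous. Since N is homogeneous and a is a form, u may be
  -- replaced by a component outside P, which dehomogenizes to a unit.
  obtain ⟨e, hue⟩ : ∃ e, (DirectSum.decompose 𝒜 u e : A) ∉ P := by
    by_contra! hall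
    refine hu ?_
    rw [← DirectSum.sum_support_decompose 𝒜 u]
    exact Ideal.sum_mem _ fun e _ => hall e
  have hmem : (DirectSum.decompose 𝒜 u e : A) * a ∈ N := by
    rw [← DirectSum.coe_decompose_mul_add_of_right_mem 𝒜 ha]
    exact ((I.comap (dehomogenize 𝒜 P ht htP)).homogeneousCore 𝒜).isHomogeneous _ hua
  have := Ideal.toIdeal_homogeneousCore_le 𝒜 _ hmem
  rw [Ideal.mem_comap, map_mul, ← mul_dehomogenize_eq 𝒜 P ht htP ha hb hbP h] at this
  exact (Ideal.mul_unit_mem_iff_mem _ (isUnit_dehomogenize 𝒜 P ht htP hb hbP)).mp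
    ((Ideal.unit_mul_mem_iff_mem _ (isUnit_dehomogenize 𝒜 P ht htP (SetLike.coe_mem _) hue)).mp this)

/-- P is generated by forms, and a form a of degree d in P is t ^ d times a / t ^ d, which is a
nonunit of the degree zero part. -/
lemma map_maximalIdeal_eq (hP : P.IsHomogeneous 𝒜) :
    (maximalIdeal (HomogeneousLocalization.AtPrime 𝒜 P)).map
      (algebraMap _ (Localization.AtPrime P)) = maximalIdeal (Localization.AtPrime P) := by
  classical
  refine le_antisymm (Ideal.map_le_iff_le_comap.mpr fun x hx => ?_) ?_
  · rw [Ideal.mem_comap, mem_maximalIdeal, mem_nonunits_iff, HomogeneousLocalization.algebraMap_apply,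
      isUnit_iff_isUnit_val]
    exact (mem_maximalIdeal _).mp hx
  · rw [← Localization.AtPrime.map_eq_maximalIdeal, Ideal.map_le_iff_le_comap]
    intro p hp
    rw [← DirectSum.sum_support_decompose 𝒜 p]
    refine Ideal.sum_mem _ fun d _ => ?_
    have hd : (DirectSum.decompose 𝒜 p d : A) ∈ P := hP d hp
    set a := (DirectSum.decompose 𝒜 p d : A)
    have ha : a ∈ 𝒜 d := SetLike.coe_mem _
    have hv := val_dehomogenize 𝒜 P ht htP ha
    have hval : algebraMap A (Localization.AtPrime P) a =
        algebraMap A (Localization.AtPrime P) (t ^ d) * (dehomogenize 𝒜 P ht htP a).val := by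
      rw [hv, Localization.mk_eq_mk', mul_comm]
      exact (IsLocalization.mk'_spec (Localization.AtPrime P) a _).symm
    rw [Ideal.mem_comap, hval]
    refine Ideal.mul_mem_left _ _ (Ideal.mem_map_of_mem (algebraMap _ _) ?_)
    rw [mem_maximalIdeal, mem_nonunits_iff, ← isUnit_iff_isUnit_val, hv, Localization.mk_eq_mk',
      IsLocalization.AtPrime.isUnit_mk'_iff (Localization.AtPrime P) P]
    exact fun h => h hd

end HomogeneousLocalization

/-! ### Two criteria on regularity of local rings -/

section LocalRings

open IsLocalRing

/-- If `S` is the quotient of `R` by an ideal that contains a nonzerodivisor and lies in the square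
of the maximal ideal, then `S` is not regular. -/
theorem not_isRegularLocalRing_of_ker_le_sq {R S : Type*} [CommRing R] [CommRing S] [IsLocalRing R]
    [IsNoetherianRing R] (ρ : R →+* S) (hρ : Function.Surjective ρ)
    (hker : RingHom.ker ρ ≤ maximalIdeal R ^ 2) {r : R} (hr : r ∈ nonZeroDivisors R)
    (hr0 : ρ r = 0) : ¬ IsRegularLocalRing S := by
  intro hS
  obtain ⟨s, hs, hspan⟩ := Submodule.FG.exists_span_finset_card_eq_spanFinrank
    (IsNoetherian.noetherian (maximalIdeal S))
  classical
  obtain ⟨g, hg⟩ := hρ.hasRightInverse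
  set T : Finset R := s.image g
  have hmap : (Ideal.span (T : Set R)).map ρ = maximalIdeal S := by
    rw [Ideal.map_span, ← hspan, Finset.coe_image, ← Set.image_comp]
    congr 1
    rw [hg.comp_eq_id, Set.image_id]
  have hloc : IsLocalHom ρ := IsLocalHom.of_surjective ρ hρ
  have hcomap : (maximalIdeal S).comap ρ = maximalIdeal R :=
    ((local_hom_TFAE ρ).out 0 4).mp hloc
  -- Nakayama: lifted generators of the maximal ideal of S generate that of R modulo the kernel,
  -- hence modulo its square.
  have hle : maximalIdeal R ≤ Ideal.span (T : Set R) := by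
    refine Submodule.le_of_le_smul_of_le_jacobson_bot (IsNoetherian.noetherian _)
      (jacobson_eq_maximalIdeal (⊥ : Ideal R) bot_ne_top).ge ?_
    rw [smul_eq_mul, ← pow_two]
    conv_lhs => rw [← hcomap, ← hmap, Ideal.comap_map_of_surjective' ρ hρ]
    exact sup_le_sup_left hker _
  have hge : Ideal.span (T : Set R) ≤ maximalIdeal R := by
    rw [← hcomap, ← Ideal.map_le_iff_le_comap, hmap]
  have hTm : maximalIdeal R = Ideal.span (T : Set R) := le_antisymm hle hge
  have h1 : (maximalIdeal R).spanFinrank ≤ (maximalIdeal S).spanFinrank := by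
    rw [← hs, hTm]
    refine (Submodule.spanFinrank_span_le_ncard_of_finite T.finite_toSet).trans ?_
    rw [Set.ncard_coe_finset]
    exact Finset.card_image_le
  -- If S were regular, then dim S + 1 ≤ dim R ≤ embdim R ≤ embdim S = dim S.
  have h2 := ringKrullDim_succ_le_of_surjective ρ hρ hr hr0
  have h3 := ringKrullDim_le_spanFinrank_maximalIdeal R
  rw [← hS.spanFinrank_maximalIdeal] at h2
  have h4 : (((maximalIdeal S).spanFinrank + 1 : ℕ) : WithBot ℕ∞) ≤
      (((maximalIdeal S).spanFinrank : ℕ) : WithBot ℕ∞) := by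
    push_cast
    exact (h2.trans h3).trans (by exact_mod_cast h1)
  have h5 : (maximalIdeal S).spanFinrank + 1 ≤ (maximalIdeal S).spanFinrank := by exact_mod_cast h4
  omega

/-- Regularity descends along a homomorphism of local rings whose ideals are all contracted and
which has trivial closed fibre. -/
theorem IsRegularLocalRing.of_map_maximalIdeal_eq {O R : Type*} [CommRing O] [CommRing R]
    [IsLocalRing O] [IsNoetherianRing O] [Algebra O R] [IsRegularLocalRing R]
    (hmap : (maximalIdeal O).map (algebraMap O R) = maximalIdeal R)
    (hcomap : ∀ (I : Ideal O) (y : O), algebraMap O R y ∈ I.map (algebraMap O R) → y ∈ I) :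
    IsRegularLocalRing O := by
  classical
  have hmem : ∀ x ∈ maximalIdeal O, algebraMap O R x ∈ maximalIdeal R := fun x hx =>
    hmap ▸ Ideal.mem_map_of_mem _ hx
  -- A system of parameters of O extends to an ideal of R over which the maximal ideal is minimal,
  -- so Krull's height theorem bounds dim R.
  have hdim : ringKrullDim R ≤ ringKrullDim O := by
    obtain ⟨s, hs, hcard⟩ :=
      (maximalIdeal O).exists_finset_card_eq_height_of_isNoetherianRing
    have hmin : maximalIdeal R ∈
        (Ideal.span ((s.image (algebraMap O R) : Finset R) : Set R)).minimalPrimes := by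
      have himg : Ideal.span ((s.image (algebraMap O R) : Finset R) : Set R) =
          (Ideal.span (s : Set O)).map (algebraMap O R) := by
        rw [Ideal.map_span, Finset.coe_image]
      rw [himg]
      refine ⟨⟨inferInstance, hmap ▸ Ideal.map_mono hs.1.2⟩, fun q hq _ => ?_⟩
      have := hq.1
      have hle : maximalIdeal O ≤ q.comap (algebraMap O R) :=
        hs.2 ⟨Ideal.comap_isPrime _ _, Ideal.map_le_iff_le_comap.mp hq.2⟩
          (le_maximalIdeal (Ideal.comap_isPrime (algebraMap O R) q).ne_top)
      exact hmap ▸ Ideal.map_le_iff_le_comap.mpr hle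
    have h := Ideal.height_le_card_of_mem_minimalPrimes_span_finset hmin
    rw [← maximalIdeal_height_eq_ringKrullDim, ← maximalIdeal_height_eq_ringKrullDim, ← hcard]
    refine WithBot.coe_le_coe.mpr (h.trans ?_)
    exact_mod_cast Finset.card_image_le
  refine IsRegularLocalRing.of_spanFinrank_maximalIdeal_le O (le_trans ?_ hdim)
  rw [← IsRegularLocalRing.spanFinrank_maximalIdeal,
    spanFinrank_maximalIdeal_eq_finrank_cotangentSpace (R := R)]
  let V := CotangentSpace R
  let w : maximalIdeal O → maximalIdeal R := fun x => ⟨algebraMap O R x, hmem x x.2⟩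
  have hw : Submodule.span R (Set.range w) = ⊤ := by
    refine Submodule.map_injective_of_injective (maximalIdeal R).subtype_injective ?_
    rw [Submodule.map_span, Submodule.map_subtype_top, ← Set.range_comp]
    conv_rhs => rw [← hmap, Ideal.map]
    congr 1
    ext y
    simp [w]
  have htop := (CotangentSpace.span_image_eq_top_iff (R := R)).mpr hw
  -- A basis of the cotangent space of R consisting of images from O. Its lifts generate the maximal
  -- ideal of R, hence that of O because ideals are contracted.
  obtain ⟨b, hbw, hbspan, hbli⟩ := exists_linearIndependent (ResidueField R)
    ((maximalIdeal R).toCotangent '' Set.range w)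
  rw [htop] at hbspan
  have hbfin : b.Finite := hbli.setFinite
  have hbcard : b.ncard = Module.finrank (ResidueField R) V := by
    rw [Module.finrank_eq_nat_card_basis (Module.Basis.mk hbli (by simp [hbspan])), Nat.card_coe_set_eq]
  have hx : ∀ y ∈ b, ∃ x : maximalIdeal O, (maximalIdeal R).toCotangent (w x) = y := fun y hy => by
    obtain ⟨_, ⟨x, rfl⟩, h⟩ := hbw hy
    exact ⟨x, h⟩
  choose! x hx using hx
  have himg : (maximalIdeal R).toCotangent '' (w '' (x '' b)) = b := by
    rw [← Set.image_comp, ← Set.image_comp]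
    exact (Set.image_congr hx).trans (Set.image_id _)
  have hspan := (CotangentSpace.span_image_eq_top_iff (R := R) (s := w '' (x '' b))).mp
    (by rw [himg, hbspan])
  set c : Set O := Subtype.val '' (x '' b)
  have hcR : maximalIdeal R = (Ideal.span c).map (algebraMap O R) := by
    have := congrArg (Submodule.map (maximalIdeal R).subtype) hspan
    rw [Submodule.map_span, Submodule.map_subtype_top] at this
    rw [← this, Ideal.map_span, Ideal.span]
    congr 1
    simp only [c, Set.image_image]
    rfl
  have hcO : maximalIdeal O = Ideal.span c := by
    refine le_antisymm (fun y hy => hcomap _ _ (hcR ▸ hmem y hy)) (Ideal.span_le.mpr ?_)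
    rintro _ ⟨y, -, rfl⟩
    exact y.2
  have hcard : (maximalIdeal O).spanFinrank ≤ Module.finrank (ResidueField R) V := by
    rw [hcO, ← hbcard]
    refine (Submodule.spanFinrank_span_le_ncard_of_finite ((hbfin.image x).image _)).trans ?_
    exact (Set.ncard_image_le (hbfin.image x)).trans (Set.ncard_image_le hbfin)
  exact_mod_cast hcard

end LocalRings

/-! ### Regularity of the local rings of Proj -/

section Proj

open HomogeneousLocalization IsLocalRing

variable {A σ : Type*} [CommRing A] [SetLike σ A] [AddSubgroupClass σ A] (𝒜 : ℕ → σ) [GradedRing 𝒜]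

theorem HomogeneousLocalization.AtPrime.isRegularLocalRing [IsNoetherianRing A] (P : Ideal A)
    [P.IsPrime] (hP : P.IsHomogeneous 𝒜) {t : A} (ht : t ∈ 𝒜 1) (htP : t ∉ P)
    [IsRegularLocalRing (Localization.AtPrime P)] :
    IsRegularLocalRing (HomogeneousLocalization.AtPrime 𝒜 P) := by
  have := AtPrime.isNoetherianRing 𝒜 P ht htP
  exact IsRegularLocalRing.of_map_maximalIdeal_eq (map_maximalIdeal_eq 𝒜 P ht htP hP)
    fun I y hy => mem_of_val_mem_map 𝒜 P ht htP hy

variable {B τ : Type*} [CommRing B] [SetLike τ B] [AddSubgroupClass τ B] {ℬ : ℕ → τ} [GradedRing ℬ]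

/-- If `f` is a form in the square of the maximal ideal of the local ring at a point of `Proj A`,
then `Proj (A ⧸ (f))` is not regular at this point. -/
theorem HomogeneousLocalization.AtPrime.not_isRegularLocalRing_of_mul_mem_sq [IsDomain A]
    [IsNoetherianRing A] (π : 𝒜 →+*ᵍ ℬ) (hπ : ∀ d, ∀ b ∈ ℬ d, ∃ a ∈ 𝒜 d, π a = b)
    (hsurj : Function.Surjective π)
    (Q : Ideal B) [Q.IsPrime] (P : Ideal A) [P.IsPrime] (hPQ : P = Q.comap π)
    (hP : P.IsHomogeneous 𝒜) {t : A} (ht : t ∈ 𝒜 1) (htP : t ∉ P) {f : A} {δ : ℕ}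
    (hf : f ∈ 𝒜 δ) (hf0 : f ≠ 0) (hker : RingHom.ker π = Ideal.span {f}) {u : A} (hu : u ∉ P)
    (huf : u * f ∈ P ^ 2) : ¬ IsRegularLocalRing (HomogeneousLocalization.AtPrime ℬ Q) := by
  have := AtPrime.isNoetherianRing 𝒜 P ht htP
  have hPQ' : ∀ b, b ∈ P.primeCompl ↔ π b ∈ Q.primeCompl := fun b => by
    subst hPQ
    exact Iff.rfl
  have hρval : ∀ x a b (hbP : b ∈ P.primeCompl), x.val = Localization.mk a ⟨b, hbP⟩ →
      (localRingHom π P Q hPQ x).val = Localization.mk (π a) ⟨π b, (hPQ' b).mp hbP⟩ := by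
    intro x a b hbP h
    refine (val_localRingHom x).trans ?_
    rw [h, Localization.mk_eq_mk', Localization.mk_eq_mk']
    exact Localization.localRingHom_mk' P Q (π : A →+* B) hPQ a ⟨b, hbP⟩
  have hfπ : π f = 0 := by
    have : f ∈ RingHom.ker π := hker ▸ Ideal.mem_span_singleton_self f
    exact this
  refine not_isRegularLocalRing_of_ker_le_sq (localRingHom π P Q hPQ) ?_ ?_
    -- The local equation f / t ^ δ of the hypersurface.
    (r := dehomogenize 𝒜 P ht htP f) ?_ ?_
  · intro y
    obtain ⟨d, a, b, ha, hb, hbQ, h⟩ := AtPrime.exists_val_eq_mk ℬ Q y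
    obtain ⟨a', ha', rfl⟩ := hπ d a ha
    obtain ⟨b', hb', rfl⟩ := hπ d b hb
    refine ⟨.mk ⟨d, ⟨a', ha'⟩, ⟨b', hb'⟩, (hPQ' b').mpr hbQ⟩, ?_⟩
    rw [ext_iff_val, h]
    exact hρval _ _ _ ((hPQ' b').mpr hbQ) (val_mk _)
  · intro x hx
    obtain ⟨d, a, b, ha, hb, hbP, h⟩ := AtPrime.exists_val_eq_mk 𝒜 P x
    have hx0 : Localization.mk (π a) ⟨π b, (hPQ' b).mp hbP⟩ = 0 := by
      rw [← hρval x a b hbP h, show localRingHom π P Q hPQ x = 0 from hx, val_zero]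
    refine mem_of_val_mem_map 𝒜 P ht htP ?_
    rw [Ideal.map_pow, map_maximalIdeal_eq 𝒜 P ht htP hP, ← Localization.AtPrime.map_eq_maximalIdeal,
      ← Ideal.map_pow, h, Localization.mk_eq_mk', IsLocalization.mk'_mem_map_algebraMap_iff]
    rw [Localization.mk_eq_mk', IsLocalization.mk'_eq_zero_iff] at hx0
    obtain ⟨⟨c, hc⟩, hca⟩ := hx0
    obtain ⟨c, rfl⟩ := hsurj c
    have hcP : c ∈ P.primeCompl := (hPQ' c).mpr hc
    have hcaf : c * a ∈ Ideal.span {f} := by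
      rw [← hker, RingHom.mem_ker]
      exact (map_mul π c a).trans hca
    obtain ⟨e, he⟩ := Ideal.mem_span_singleton'.mp hcaf
    -- With c * a = e * f, the product u * c * a = e * (u * f) lies in P ^ 2.
    refine ⟨u * c, P.primeCompl.mul_mem hu hcP, ?_⟩
    rw [mul_assoc, ← he, mul_left_comm]
    exact Ideal.mul_mem_left _ _ huf
  · rw [mem_nonZeroDivisors_iff_right]
    intro x hx
    rw [ext_iff_val, val_zero]
    have := congrArg HomogeneousLocalization.val hx
    rw [val_mul, val_zero] at this
    refine (mul_eq_zero.mp this).resolve_right ?_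
    rw [val_dehomogenize 𝒜 P ht htP hf, Localization.mk_eq_mk', IsLocalization.mk'_eq_zero_iff]
    rintro ⟨⟨c, hc⟩, hcf⟩
    exact (mul_ne_zero (fun h0 : c = 0 => hc (h0 ▸ P.zero_mem)) hf0) hcf
  · rw [ext_iff_val, hρval _ _ _ _ (val_dehomogenize 𝒜 P ht htP hf), val_zero,
      Localization.mk_eq_mk', IsLocalization.mk'_eq_zero_iff]
    exact ⟨1, by simp [hfπ]⟩

end Proj

/-! ### Dimension as length of chains of specializations -/

section Topology

open TopologicalSpace

variable {Y Q : Type*} [TopologicalSpace Y] [PartialOrder Q]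

/-- Chains of points ordered by specialization bound the dimension from below. -/
lemma krullDim_image_le_topologicalKrullDim (φ : Y → Q) (hφ : ∀ x y, x ⤳ y ↔ φ x ≤ φ y)
    (T : Set Y) : Order.krullDim (φ '' T) ≤ topologicalKrullDim T := by
  -- A larger prime has a smaller closure, so the order is reversed.
  rw [topologicalKrullDim, ← Order.krullDim_orderDual (α := IrreducibleCloseds T)]
  choose g hg using fun q : φ '' T => q.2
  have hcl : ∀ a b : φ '' T, (closure {(⟨g b, (hg b).1⟩ : T)} ⊆ closure {(⟨g a, (hg a).1⟩ : T)}) ↔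
      a ≤ b := fun a b => by
    rw [← specializes_iff_closure_subset, ← Topology.IsInducing.subtypeVal.specializes_iff, hφ]
    change φ (g a) ≤ φ (g b) ↔ _
    rw [(hg a).2, (hg b).2]
    rfl
  refine Order.krullDim_le_of_strictMono (fun q : φ '' T => OrderDual.toDual
    (⟨closure {(⟨g q, (hg q).1⟩ : T)}, isIrreducible_singleton.closure, isClosed_closure⟩ :
      IrreducibleCloseds T)) fun a b hab => ?_
  rw [OrderDual.toDual_lt_toDual]
  refine lt_of_le_not_ge ((hcl a b).mpr hab.le) fun h => hab.not_ge ((hcl b a).mp h)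

/-- The dimension of a sober space is the supremum of the lengths of chains of specializations. -/
lemma topologicalKrullDim_eq_krullDim_range [QuasiSober Y] (φ : Y → Q)
    (hφ : ∀ x y, x ⤳ y ↔ φ x ≤ φ y) : topologicalKrullDim Y = Order.krullDim (Set.range φ) := by
  refine le_antisymm ?_ ?_
  · rw [topologicalKrullDim, ← Order.krullDim_orderDual (α := IrreducibleCloseds Y)]
    choose g hg using fun Z : IrreducibleCloseds Y => QuasiSober.sober Z.isIrreducible Z.isClosed
    have hcl : ∀ Z W : IrreducibleCloseds Y, Z ≤ W ↔ φ (g W) ≤ φ (g Z) := fun Z W => by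
      rw [← hφ, specializes_iff_closure_subset, (hg Z).def, (hg W).def]
      rfl
    refine Order.krullDim_le_of_strictMono
      (fun Z => (⟨φ (g (OrderDual.ofDual Z)), Set.mem_range_self _⟩ : Set.range φ)) fun Z W h => ?_
    refine lt_of_le_not_ge ((hcl _ _).mp h.le) fun h' => h.not_ge ((hcl _ _).mpr h')
  · rw [← Set.image_univ]
    exact (krullDim_image_le_topologicalKrullDim φ hφ Set.univ).trans
      (topologicalKrullDim_subspace_le Y Set.univ)

end Topology

/-! ### Points of Proj of a quotient inside the ambient Proj -/

section QuotientProj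

open HomogeneousIdeal ProjHypersurface

variable {k A : Type u} [Field k] [CommRing A] [Algebra k A] (𝒜 : ℕ → Submodule k A)
  [GradedAlgebra 𝒜]

namespace ProjHypersurface

/-- The projection to the quotient by a homogeneous ideal, as a graded ring homomorphism. -/
def quotientHom (I : HomogeneousIdeal 𝒜) : 𝒜 →+*ᵍ quotientGrading 𝒜 I.toIdeal where
  __ := Ideal.Quotient.mk I.toIdeal
  map_mem {_ x} hx := ⟨x, hx, rfl⟩

lemma quotientHom_surjective (I : HomogeneousIdeal 𝒜) : Function.Surjective (quotientHom 𝒜 I) :=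
  Ideal.Quotient.mk_surjective

/-- This condition makes contraction of primes defined on all of Proj (A ⧸ I). -/
lemma irrelevant_le_map_quotientHom (I : HomogeneousIdeal 𝒜) :
    irrelevant (quotientGrading 𝒜 I.toIdeal) ≤ (irrelevant 𝒜).map (quotientHom 𝒜 I) := by
  refine (irrelevant_le _).mpr fun i hi => ?_
  rintro _ ⟨a, ha, rfl⟩
  exact Ideal.mem_map_of_mem (quotientHom 𝒜 I) (mem_irrelevant_of_mem 𝒜 hi ha)

/-- The closed embedding `Proj (A ⧸ I) → Proj A` on points. -/
noncomputable def toAmbient (I : HomogeneousIdeal 𝒜) (x : Proj (quotientGrading 𝒜 I.toIdeal)) :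
    ProjectiveSpectrum 𝒜 :=
  ProjectiveSpectrum.comap (quotientHom 𝒜 I) (irrelevant_le_map_quotientHom 𝒜 I) x

lemma specializes_iff_toAmbient_le (I : HomogeneousIdeal 𝒜)
    (x y : Proj (quotientGrading 𝒜 I.toIdeal)) :
    x ⤳ y ↔ toAmbient 𝒜 I x ≤ toAmbient 𝒜 I y := by
  rw [specializes_iff_mem_closure]
  refine (ProjectiveSpectrum.le_iff_mem_closure _ x y).symm.trans ?_
  exact (Ideal.comap_le_comap_iff_of_surjective _ (quotientHom_surjective 𝒜 I) _ _).symm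

lemma range_toAmbient (I : HomogeneousIdeal 𝒜) :
    Set.range (toAmbient 𝒜 I) = ProjectiveSpectrum.zeroLocus 𝒜 (I : Set A) := by
  ext p
  constructor
  · rintro ⟨x, rfl⟩ a ha
    change (quotientHom 𝒜 I) a ∈ x.asHomogeneousIdeal
    rw [show quotientHom 𝒜 I a = 0 from Ideal.Quotient.eq_zero_iff_mem.mpr ha]
    exact zero_mem _
  · intro hp
    have hker : RingHom.ker (Ideal.Quotient.mk I.toIdeal) ≤ p.asHomogeneousIdeal.toIdeal := by
      rw [Ideal.mk_ker]
      exact hp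
    have hcomap : ((p.asHomogeneousIdeal.map (quotientHom 𝒜 I)).comap (quotientHom 𝒜 I)) =
        p.asHomogeneousIdeal := by
      refine HomogeneousIdeal.toIdeal_injective ?_
      refine (Ideal.comap_map_of_surjective' _ (quotientHom_surjective 𝒜 I) _).trans ?_
      exact sup_eq_left.mpr hker
    have hprime := Ideal.map_isPrime_of_surjective (f := Ideal.Quotient.mk I.toIdeal)
      Ideal.Quotient.mk_surjective hker
    refine ⟨⟨p.asHomogeneousIdeal.map (quotientHom 𝒜 I), hprime, fun h => ?_⟩,
      ProjectiveSpectrum.ext hcomap⟩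
    refine p.not_irrelevant_le ((irrelevant_le _).mpr fun i hi a ha => ?_)
    rw [← hcomap]
    exact h (mem_irrelevant_of_mem _ hi ⟨a, ha, rfl⟩)

end ProjHypersurface

end QuotientProj

/-! ### Dimension, components and singular points of V(S) -/

namespace ProjHypersurface

attribute [local instance] MvPolynomial.gradedAlgebra

open MvPolynomial

variable {n : ℕ} {k : Type u} [Field k]

/-- A homogeneous ideal containing all the variables contains the irrelevant ideal. -/
lemma irrelevant_le_of_X_mem {I : Ideal (MvPolynomial (Fin (n + 1)) k)} (hI : ∀ i, X i ∈ I) :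
    (HomogeneousIdeal.irrelevant (homogeneousSubmodule (Fin (n + 1)) k)).toIdeal ≤ I := by
  refine (HomogeneousIdeal.toIdeal_irrelevant_le _).mpr fun d hd a ha => ?_
  rw [a.as_sum]
  refine Ideal.sum_mem _ fun m hm => ?_
  have hdeg : m.degree = d := by
    have := ha (mem_support_iff.mp hm)
    rw [Finsupp.degree_eq_weight_one]
    exact this
  obtain ⟨i, hi⟩ : ∃ i, m i ≠ 0 := by
    by_contra! h
    have : m = 0 := Finsupp.ext h
    rw [this, map_zero] at hdeg
    omega
  exact Ideal.mem_of_dvd _ ((X_dvd_monomial).mpr (Or.inr hi)) (hI i)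

lemma exists_X_notMem (p : ProjectiveSpectrum (homogeneousSubmodule (Fin (n + 1)) k)) :
    ∃ i, X i ∉ p.asHomogeneousIdeal.toIdeal := by
  by_contra! h
  exact p.not_irrelevant_le (irrelevant_le_of_X_mem h)

/-- The point of projective space given by a homogeneous prime ideal that omits a variable. -/
def pointOfPrime (P : Ideal (MvPolynomial (Fin (n + 1)) k)) (hP : P.IsPrime)
    (hhom : P.IsHomogeneous (homogeneousSubmodule (Fin (n + 1)) k)) {i : Fin (n + 1)}
    (hi : X i ∉ P) : ProjectiveSpectrum (homogeneousSubmodule (Fin (n + 1)) k) where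
  asHomogeneousIdeal := ⟨P, hhom⟩
  isPrime := hP
  not_irrelevant_le h := hi (h (HomogeneousIdeal.mem_irrelevant_of_mem _ one_pos
    (isHomogeneous_X k i)))

variable {S : Set (MvPolynomial (Fin (n + 1)) k)}

lemma zeroLocus_homogeneousIdeal (hS : ∀ p ∈ S, ∃ d, p.IsHomogeneous d) :
    ProjectiveSpectrum.zeroLocus (homogeneousSubmodule (Fin (n + 1)) k)
      (homogeneousIdeal S : Set (MvPolynomial (Fin (n + 1)) k)) =
    ProjectiveSpectrum.zeroLocus (homogeneousSubmodule (Fin (n + 1)) k) S := by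
  rw [← ProjectiveSpectrum.zeroLocus_span _ S, ← toIdeal_homogeneousIdeal hS]
  rfl

lemma topologicalKrullDim_V (hS : ∀ p ∈ S, ∃ d, p.IsHomogeneous d) :
    topologicalKrullDim (V S) = Order.krullDim
      (ProjectiveSpectrum.zeroLocus (homogeneousSubmodule (Fin (n + 1)) k) S) := by
  rw [← zeroLocus_homogeneousIdeal hS, ← range_toAmbient]
  exact topologicalKrullDim_eq_krullDim_range (Y := V S) _ (specializes_iff_toAmbient_le _ _)

lemma isHomogeneous_span (hS : ∀ p ∈ S, ∃ d, p.IsHomogeneous d) :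
    (Ideal.span S).IsHomogeneous (homogeneousSubmodule (Fin (n + 1)) k) :=
  Ideal.homogeneous_span _ S fun p hp => hS p hp

/-- The point p is the image of the generic point of Z. Every prime above it is a point of Z, so
chains above p bound dim Z from below. -/
lemma exists_minimalPrimes_of_mem_irreducibleComponents (hS : ∀ p ∈ S, ∃ d, p.IsHomogeneous d)
    {Z : Set (V S)} (hZ : Z ∈ irreducibleComponents (V S)) :
    ∃ p : ProjectiveSpectrum (homogeneousSubmodule (Fin (n + 1)) k),
      p.asHomogeneousIdeal.toIdeal ∈ (Ideal.span S).minimalPrimes ∧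
      Order.krullDim (Set.Ici p) ≤ topologicalKrullDim Z := by
  set φ : V S → _ := toAmbient (homogeneousSubmodule (Fin (n + 1)) k) (homogeneousIdeal S)
  have hφ : ∀ x y : V S, x ⤳ y ↔ φ x ≤ φ y := specializes_iff_toAmbient_le _ _
  have hrange : Set.range φ = ProjectiveSpectrum.zeroLocus _ S :=
    (range_toAmbient _ (homogeneousIdeal S)).trans (zeroLocus_homogeneousIdeal hS)
  have hclosed : IsClosed Z := isClosed_of_mem_irreducibleComponents Z hZ
  obtain ⟨x, hx⟩ := QuasiSober.sober hZ.prop hclosed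
  have hxS : φ x ∈ ProjectiveSpectrum.zeroLocus _ S := hrange ▸ Set.mem_range_self x
  refine ⟨φ x, ⟨⟨(φ x).isPrime, Ideal.span_le.mpr hxS⟩, ?_⟩, ?_⟩
  · rintro P ⟨hP, hSP⟩ hPx
    obtain ⟨P', hP', hP'P⟩ := Ideal.exists_minimalPrimes_le hSP
    obtain ⟨i, hi⟩ := exists_X_notMem (φ x)
    have hhom : P'.IsHomogeneous (homogeneousSubmodule (Fin (n + 1)) k) :=
      (isHomogeneous_span hS).of_mem_minimalPrimes _ hP'
    -- A minimal prime below the generic point x is again a point of V(S). Its closure contains Z,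
    -- so maximality of Z makes it equivalent to x.
    set q := pointOfPrime P' hP'.1.1 hhom fun h => hi (hPx (hP'P h))
    have hq : q ∈ Set.range φ := by
      rw [hrange]
      exact Set.Subset.trans Ideal.subset_span hP'.1.2
    obtain ⟨y, hy⟩ := hq
    have hyx : y ⤳ x := (hφ y x).mpr (hy ▸ (hP'P.trans hPx :))
    have hle : Z ⊆ closure {y} := by
      rw [← hx.def]
      exact hyx.closure_subset
    have hyZ : y ∈ Z := hZ.le_of_ge isIrreducible_singleton.closure hle (subset_closure rfl)
    have := (hφ x y).mp (hx.specializes hyZ)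
    rw [hy] at this
    exact (show (φ x).asHomogeneousIdeal.toIdeal ≤ P' from this).trans hP'P
  · refine le_trans ?_ (krullDim_image_le_topologicalKrullDim φ hφ Z)
    have hsub : Set.Ici (φ x) ⊆ φ '' Z := by
      intro q hq
      obtain ⟨y, rfl⟩ : q ∈ Set.range φ := by
        rw [hrange]
        exact Set.Subset.trans hxS hq
      have hy := specializes_iff_mem_closure.mp ((hφ x y).mpr hq)
      rw [hx.def] at hy
      exact ⟨y, hy, rfl⟩
    exact Order.krullDim_le_of_strictMono (Set.inclusion hsub) fun a b h => h

/-- Points of `V(f)` at which `f` and all its partial derivatives vanish are singular. -/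
lemma mem_singularLocus [PerfectField k] {f : MvPolynomial (Fin (n + 1)) k} {δ : ℕ}
    (hf : f.IsHomogeneous δ) (hf0 : f ≠ 0) (x : V {f})
    (hx : ∀ i, pderiv i f ∈ (toAmbient (homogeneousSubmodule (Fin (n + 1)) k)
      (homogeneousIdeal {f}) x).asHomogeneousIdeal.toIdeal) : x ∈ singularLocus (V {f}) := by
  intro hreg
  set p := toAmbient (homogeneousSubmodule (Fin (n + 1)) k) (homogeneousIdeal {f}) x
  have hS : ∀ g ∈ ({f} : Set (MvPolynomial (Fin (n + 1)) k)), ∃ d, g.IsHomogeneous d := by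
    rintro _ rfl
    exact ⟨δ, hf⟩
  have hpS : p ∈ ProjectiveSpectrum.zeroLocus _ {f} := by
    rw [← zeroLocus_homogeneousIdeal hS, ← range_toAmbient]
    exact Set.mem_range_self x
  obtain ⟨i, hi⟩ := exists_X_notMem p
  obtain ⟨u, hu, huf⟩ := exists_mul_mem_sq_of_pderiv_mem p.asHomogeneousIdeal.toIdeal
    (Set.singleton_subset_iff.mp hpS) hx
  have hker : RingHom.ker (quotientHom (homogeneousSubmodule (Fin (n + 1)) k)
      (homogeneousIdeal {f})) = Ideal.span {f} :=
    (Ideal.mk_ker (I := (homogeneousIdeal {f}).toIdeal)).trans (toIdeal_homogeneousIdeal hS)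
  have hQ : (ProjectiveSpectrum.asHomogeneousIdeal x).toIdeal.IsPrime :=
    ProjectiveSpectrum.isPrime x
  refine HomogeneousLocalization.AtPrime.not_isRegularLocalRing_of_mul_mem_sq _
    (quotientHom (homogeneousSubmodule (Fin (n + 1)) k) (homogeneousIdeal {f}))
    (fun d b hb => ?_) (quotientHom_surjective _ _)
    (ProjectiveSpectrum.asHomogeneousIdeal x).toIdeal p.asHomogeneousIdeal.toIdeal rfl
    p.asHomogeneousIdeal.isHomogeneous (isHomogeneous_X k i) hi hf hf0 hker hu huf ?_
  · obtain ⟨a, ha, rfl⟩ := hb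
    exact ⟨a, ha, rfl⟩
  · exact @IsRegularLocalRing.of_ringEquiv _ _ hreg _ _ (Proj.stalkIso' _ x)

end ProjHypersurface

/-! ### Hypersurfaces of degree at most one are empty or regular -/

section LinearForm

open MvPolynomial

/-- The homogeneous coordinate ring of a hyperplane is regular. -/
theorem isRegularRing_quotient_span_linearForm {σ k : Type*} [Fintype σ] [Field k] (c : σ → k) {i : σ}
    (hi : c i ≠ 0) :
    IsRegularRing (MvPolynomial σ k ⧸ Ideal.span {∑ j, c j • (X j : MvPolynomial σ k)}) := by
  classical
  set f : MvPolynomial σ k := ∑ j, c j • X j with hf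
  let τ := {j : σ // j ≠ i}
  -- Solving f = 0 for `X i` identifies the quotient with the polynomial ring in the remaining
  -- variables.
  let ψ : MvPolynomial σ k →ₐ[k] MvPolynomial τ k := aeval fun j =>
    if h : j = i then -∑ l : τ, (c l / c i) • X l else X ⟨j, h⟩
  let ι : MvPolynomial τ k →ₐ[k] MvPolynomial σ k := rename Subtype.val
  have hψi : ψ (X i) = -∑ l : τ, (c l / c i) • X l := by simp [ψ]
  have hψ : ∀ l : τ, ψ (X l) = X l := fun l => by simp [ψ, l.2]
  have hψι : ∀ b, ψ (ι b) = b := fun b => by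
    have : ψ.comp ι = AlgHom.id k _ := by
      refine MvPolynomial.algHom_ext fun l => ?_
      simp [ι, hψ]
    exact DFunLike.congr_fun this b
  have hsum : f = c i • X i + ∑ l : τ, c l • X (l : σ) := by
    rw [hf, ← Finset.add_sum_erase _ _ (Finset.mem_univ i)]
    congr 1
    refine (Finset.sum_subtype _ (fun x => ?_) fun j => c j • (X j : MvPolynomial σ k))
    simp
  have hψf : ψ f = 0 := by
    rw [hsum, map_add, map_sum, map_smul, hψi]
    simp only [map_smul, hψ, smul_neg, Finset.smul_sum, smul_smul]
    rw [neg_add_eq_zero]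
    exact Finset.sum_congr rfl fun l _ => by rw [mul_div_cancel₀ _ hi]
  have hmk : ∀ a, Ideal.Quotient.mk (Ideal.span {f}) (ι (ψ a)) = Ideal.Quotient.mk _ a := fun a => by
    have : ((Ideal.Quotient.mkₐ k (Ideal.span {f})).comp (ι.comp ψ)) = Ideal.Quotient.mkₐ k _ := by
      refine MvPolynomial.algHom_ext fun j => ?_
      by_cases hj : j = i
      · subst hj
        change Ideal.Quotient.mk _ (ι (ψ (X j))) = Ideal.Quotient.mk _ (X j)
        rw [Ideal.Quotient.eq, hψi]
        have : ι (-∑ l : τ, (c l / c j) • X l) - X j = (-(c j)⁻¹) • f := by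
          rw [hsum]
          simp [ι, smul_smul, Finset.smul_sum, div_eq_inv_mul, hi]
          ring
        rw [this, Algebra.smul_def]
        exact Ideal.mul_mem_left _ _ (Ideal.mem_span_singleton_self f)
      · have h := hψ ⟨j, hj⟩
        simp only [AlgHom.comp_apply]
        rw [h]
        simp [ι]
    exact DFunLike.congr_fun this a
  have hker : RingHom.ker ψ = Ideal.span {f} := by
    refine le_antisymm (fun a ha => ?_) ?_
    · have ha' := hmk a
      rw [(RingHom.mem_ker).mp ha, map_zero, map_zero] at ha'
      exact Ideal.Quotient.eq_zero_iff_mem.mp ha'.symm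
    · rw [Ideal.span_singleton_le_iff_mem]
      exact hψf
  rw [← hker]
  exact IsRegularRing.of_ringEquiv (RingHom.quotientKerEquivOfRightInverse hψι).symm

end LinearForm

namespace ProjHypersurface

attribute [local instance] MvPolynomial.gradedAlgebra

open MvPolynomial

variable {n : ℕ} {k : Type u} [Field k]

/-- A form with a singular zero has degree at least two. -/
theorem two_le_of_mem_singularLocus {f : MvPolynomial (Fin (n + 1)) k} {δ : ℕ}
    (hf : f.IsHomogeneous δ) (hf0 : f ≠ 0) {x : V {f}} (hx : x ∈ singularLocus (V {f})) :
    2 ≤ δ := by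
  by_contra! hδ
  have hS : ∀ g ∈ ({f} : Set (MvPolynomial (Fin (n + 1)) k)), ∃ d, g.IsHomogeneous d := by
    rintro _ rfl
    exact ⟨δ, hf⟩
  set p := toAmbient (homogeneousSubmodule (Fin (n + 1)) k) (homogeneousIdeal {f}) x
  have hpS : p ∈ ProjectiveSpectrum.zeroLocus _ {f} := by
    rw [← zeroLocus_homogeneousIdeal hS, ← range_toAmbient]
    exact Set.mem_range_self x
  have hfp : f ∈ p.asHomogeneousIdeal.toIdeal := Set.singleton_subset_iff.mp hpS
  obtain ⟨t, ht⟩ := exists_X_notMem p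
  interval_cases δ
  · have : f ∈ homogeneousSubmodule (Fin (n + 1)) k 0 := hf
    rw [homogeneousSubmodule_zero, Submodule.mem_one] at this
    obtain ⟨c, rfl⟩ := this
    refine p.isPrime.ne_top (Ideal.eq_top_of_isUnit_mem _ hfp ?_)
    exact (IsUnit.mk0 c fun h => hf0 (by rw [h, map_zero])).map _
  · have : f ∈ homogeneousSubmodule (Fin (n + 1)) k 1 := hf
    rw [homogeneousSubmodule_one_eq_span_X, Submodule.mem_span_range_iff_exists_fun] at this
    obtain ⟨c, hc⟩ := this
    obtain ⟨i, hi⟩ : ∃ i, c i ≠ 0 := by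
      by_contra! h
      exact hf0 (by simp [← hc, h])
    have hreg := isRegularRing_quotient_span_linearForm c hi
    rw [hc, ← toIdeal_homogeneousIdeal hS] at hreg
    have hQ : (ProjectiveSpectrum.asHomogeneousIdeal x).toIdeal.IsPrime :=
      ProjectiveSpectrum.isPrime x
    have := HomogeneousLocalization.AtPrime.isRegularLocalRing
      (quotientGrading (homogeneousSubmodule (Fin (n + 1)) k) (homogeneousIdeal {f}).toIdeal)
      (ProjectiveSpectrum.asHomogeneousIdeal x).toIdeal
      (ProjectiveSpectrum.asHomogeneousIdeal x).isHomogeneous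
      (t := Ideal.Quotient.mk _ (X t)) ⟨X t, isHomogeneous_X k t, rfl⟩ ht
    exact hx (@IsRegularLocalRing.of_ringEquiv _ _ this _ _ (Proj.stalkIso' _ x).symm)

end ProjHypersurface

/-! ### Generic elements of a subspace; heights in integral extensions -/

section Height

/-- Generic linear combinations of the elements of a subspace cut down the dimension of a closed
set as long as the subspace does not vanish on it. -/
theorem exists_forall_le_or_le_height {K A : Type*} [Field K] [Infinite K] [CommRing A] [IsDomain A]
    [IsNoetherianRing A] [Algebra K A] {W : Submodule K A} (hW : W ≠ ⊥) {f : A} (hf : f ≠ 0) (j : ℕ) :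
    ∃ g : Fin j → A, (∀ i, g i ∈ W) ∧ (∀ i, g i ≠ 0) ∧ ∀ P : Ideal A, P.IsPrime →
      insert f (Set.range g) ⊆ (P : Set A) → (W : Set A) ⊆ P ∨ (j + 1 : ℕ) ≤ P.height := by
  classical
  induction j with
  | zero =>
    refine ⟨Fin.elim0, fun i => i.elim0, fun i => i.elim0, fun P hP hfP => Or.inr ?_⟩
    have hlt : (⊥ : Ideal A) < P := bot_lt_iff_ne_bot.mpr fun h =>
      hf ((Submodule.mem_bot A).mp (h ▸ hfP (Set.mem_insert f _)))
    have := Ideal.height_add_one_le_of_lt_of_isPrime hlt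
    simpa using this
  | succ j ih =>
    obtain ⟨g, hgW, hg0, hg⟩ := ih
    set I := Ideal.span (insert f (Set.range g))
    have hfin : {P ∈ I.minimalPrimes | ¬ (W : Set A) ⊆ P}.Finite :=
      (I.finite_minimalPrimes_of_isNoetherianRing).subset fun P hP => hP.1
    -- Proper subspaces to be avoided: the traces on W of the minimal primes not containing W, and 0
    -- so that the new element is non-zero. Over an infinite field finitely many of them do not
    -- cover W.
    set s : Finset (Subspace K W) := insert ⊥ (hfin.toFinset.image fun P =>
      (P.restrictScalars K).comap W.subtype)
    have hs : ⊤ ∉ s := by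
      intro h
      rcases Finset.mem_insert.mp h with h | h
      · refine hW ((Submodule.eq_bot_iff _).mpr fun x hx => ?_)
        have : (⟨x, hx⟩ : W) ∈ (⊥ : Subspace K W) := h ▸ Submodule.mem_top
        exact congrArg Subtype.val ((Submodule.mem_bot K).mp this)
      · obtain ⟨P, hP, h⟩ := Finset.mem_image.mp h
        refine (hfin.mem_toFinset.mp hP).2 fun x hx => ?_
        have : (⟨x, hx⟩ : W) ∈ (P.restrictScalars K).comap W.subtype := h ▸ Submodule.mem_top
        exact this
    obtain ⟨w, hw⟩ := (Set.ne_univ_iff_exists_notMem _).mp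
      (Subspace.biUnion_ne_univ_of_top_notMem hs)
    simp only [Set.mem_iUnion, not_exists] at hw
    refine ⟨Fin.snoc g w, ?_, ?_, fun Q hQ hgQ => ?_⟩
    · refine Fin.lastCases ?_ fun i => ?_
      · simp
      · simpa using hgW i
    · refine Fin.lastCases ?_ fun i => ?_
      · simpa using fun h => hw ⊥ (Finset.mem_insert_self _ _) h
      · simpa using hg0 i
    · have hwQ : (w : A) ∈ Q := hgQ (Set.mem_insert_of_mem _ ⟨Fin.last j, by simp⟩)
      have hIQ : I ≤ Q := Ideal.span_le.mpr (Set.insert_subset (hgQ (Set.mem_insert _ _)) (by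
        rintro _ ⟨i, rfl⟩
        exact hgQ (Set.mem_insert_of_mem _ ⟨i.castSucc, by simp⟩)))
      obtain ⟨P, hP, hPQ⟩ := Ideal.exists_minimalPrimes_le hIQ
      have := hP.1.1
      by_cases hWP : (W : Set A) ⊆ P
      · exact Or.inl (hWP.trans hPQ)
      · right
        have hht := (hg P hP.1.1 (Ideal.span_le.mp hP.1.2)).resolve_left hWP
        have hwP : (w : A) ∉ P := fun h => hw _ (Finset.mem_insert_of_mem
          (Finset.mem_image_of_mem _ (hfin.mem_toFinset.mpr ⟨hP, hWP⟩))) h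
        -- The new element lies in Q but not in P, so the height grows by one.
        have hlt : P < Q := lt_of_le_of_ne hPQ fun h => hwP (h ▸ hwQ)
        refine le_trans ?_ (Ideal.height_add_one_le_of_lt_of_isPrime hlt)
        push_cast at hht ⊢
        gcongr

/-- Heights do not grow in integral extensions. -/
lemma Ideal.height_le_height_comap_of_isIntegral {R A : Type*} [CommRing R] [CommRing A] [Algebra R A]
    [Algebra.IsIntegral R A] (Q : Ideal A) [hQ : Q.IsPrime] :
    Q.height ≤ (Q.comap (algebraMap R A)).height := by
  have := PrimeSpectrum.height_eq_orderHeight (R := A) ⟨Q, hQ⟩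
  rw [show Q.height = _ from this]
  have := PrimeSpectrum.height_eq_orderHeight (R := R) ⟨Q.comap (algebraMap R A), inferInstance⟩
  rw [show (Q.comap (algebraMap R A)).height = _ from this]
  refine Order.height_le_height_apply_of_strictMono (PrimeSpectrum.comap (algebraMap R A)) ?_ _
  exact fun P P' h => Ideal.IsIntegral.comap_lt_comap h

end Height

/-! ### The irrelevant ideal as the kernel of the constant coefficient -/

namespace MvPolynomial

variable {σ k : Type*} [Field k]

attribute [local instance] gradedAlgebra

lemma le_ker_constantCoeff {P : Ideal (MvPolynomial σ k)}
    (hP : P.IsHomogeneous (homogeneousSubmodule σ k)) (htop : P ≠ ⊤) :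
    P ≤ RingHom.ker (constantCoeff (R := k) (σ := σ)) := by
  intro a ha
  by_contra h
  have h0 : C (coeff 0 a) ∈ P := by
    rw [← homogeneousComponent_zero, ← decomposition.decompose'_apply]
    exact hP 0 ha
  exact htop (Ideal.eq_top_of_isUnit_mem _ h0 ((IsUnit.mk0 _ h).map C))

lemma ker_constantCoeff_le {P : Ideal (MvPolynomial σ k)} (hP : ∀ i, X i ∈ P) :
    RingHom.ker (constantCoeff (R := k) (σ := σ)) ≤ P := by
  intro a ha
  have h : (Ideal.Quotient.mk P) = ((Ideal.Quotient.mk P).comp C).comp constantCoeff := by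
    refine ringHom_ext (fun c => by simp) fun i => ?_
    simpa using Ideal.Quotient.eq_zero_iff_mem.mpr (hP i)
  rw [← Ideal.Quotient.eq_zero_iff_mem, h, RingHom.comp_apply, (RingHom.mem_ker).mp ha, map_zero]

lemma height_ker_constantCoeff (n : ℕ) :
    (RingHom.ker (constantCoeff (R := k) (σ := Fin n))).height = n := by
  have : (RingHom.ker (constantCoeff (R := k) (σ := Fin n))).IsMaximal :=
    RingHom.ker_isMaximal_of_surjective _ fun c => ⟨C c, constantCoeff_C _ c⟩
  exact height_eq_of_isMaximal n _

end MvPolynomial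

/-! ### Dimension theory of closed subsets of projective space -/

namespace ProjHypersurface

attribute [local instance] MvPolynomial.gradedAlgebra

open MvPolynomial

variable {n : ℕ} {k : Type u} [Field k]

/-- The height of a relevant homogeneous prime ideal plus the dimension of its zero locus is at
most `n`. -/
lemma height_add_length_le (l : LTSeries (ProjectiveSpectrum (homogeneousSubmodule (Fin (n + 1)) k))) :
    l.head.asHomogeneousIdeal.toIdeal.height + l.length ≤ n := by
  have h : ∀ (i : ℕ) (hi : i < l.length + 1), l.head.asHomogeneousIdeal.toIdeal.height + i ≤
      (l ⟨i, hi⟩).asHomogeneousIdeal.toIdeal.height := by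
    intro i
    induction i with
    | zero => exact fun _ => by simp [RelSeries.head]
    | succ i ih =>
      intro hi
      have hlt : (l ⟨i, by omega⟩).asHomogeneousIdeal.toIdeal <
          (l ⟨i + 1, hi⟩).asHomogeneousIdeal.toIdeal :=
        l.strictMono (Fin.mk_lt_mk.mpr (Nat.lt_succ_self i))
      refine le_trans ?_ (Ideal.height_add_one_le_of_lt_of_isPrime hlt)
      push_cast
      rw [← add_assoc]
      gcongr
      exact ih _
  set p := l ⟨l.length, by omega⟩
  obtain ⟨i, hi⟩ := exists_X_notMem p
  have hprime : (RingHom.ker (constantCoeff (R := k) (σ := Fin (n + 1)))).IsPrime :=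
    RingHom.ker_isPrime _
  -- The irrelevant ideal, of height n + 1, extends the chain by one step; hence the bound n.
  have hlt : p.asHomogeneousIdeal.toIdeal < RingHom.ker constantCoeff :=
    lt_of_le_of_ne (le_ker_constantCoeff p.asHomogeneousIdeal.isHomogeneous p.isPrime.ne_top)
      fun h => hi (h ▸ constantCoeff_X _ i)
  have := (add_le_add_left (h l.length (by omega)) 1).trans
    (Ideal.height_add_one_le_of_lt_of_isPrime hlt)
  rw [height_ker_constantCoeff, Nat.cast_add, Nat.cast_one] at this
  exact (ENat.add_le_add_iff_right (by simp)).mp this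

/-- If a closed subset contains a closed subset of dimension at most `s`, and its points outside of
it have codimension at least `n - s`, then it has dimension at most `s`. -/
lemma krullDim_zeroLocus_le {S T : Set (MvPolynomial (Fin (n + 1)) k)} {r s : ℕ} (hrs : n ≤ s + r)
    (hST : ∀ P : Ideal (MvPolynomial (Fin (n + 1)) k), P.IsPrime → S ⊆ P → T ⊆ P ∨ r ≤ P.height)
    (hT : Order.krullDim (ProjectiveSpectrum.zeroLocus (homogeneousSubmodule (Fin (n + 1)) k) T) ≤ s) :
    Order.krullDim (ProjectiveSpectrum.zeroLocus (homogeneousSubmodule (Fin (n + 1)) k) S) ≤ s := by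
  refine iSup_le fun l => ?_
  let l' := l.map Subtype.val (fun _ _ h => h)
  rcases hST l'.head.asHomogeneousIdeal.toIdeal l'.head.isPrime l.head.2 with h | h
  · let l'' : LTSeries (ProjectiveSpectrum.zeroLocus (homogeneousSubmodule (Fin (n + 1)) k) T) :=
      LTSeries.mk l'.length (fun i => ⟨l' i, h.trans (l'.monotone (Fin.zero_le i))⟩)
        fun i j hij => l'.strictMono hij
    exact (Order.LTSeries.length_le_krullDim l'').trans hT
  · have := (add_le_add_left h (l'.length : ℕ∞)).trans (height_add_length_le l')
    have : r + l.length ≤ n := by exact_mod_cast this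
    have : l.length ≤ s := by omega
    exact_mod_cast this

/-- Components of closed subsets of projective space cut out by `r` forms have dimension at least
`n - r`. -/
lemma le_krullDim_Ici {S : Set (MvPolynomial (Fin (n + 1)) k)} (hS : ∀ p ∈ S, ∃ d, p.IsHomogeneous d)
    {r s : ℕ} (hr : S.encard ≤ r) (hrs : s + r ≤ n)
    {p : ProjectiveSpectrum (homogeneousSubmodule (Fin (n + 1)) k)}
    (hp : p.asHomogeneousIdeal.toIdeal ∈ (Ideal.span S).minimalPrimes) :
    (s : WithBot ℕ∞) ≤ Order.krullDim (Set.Ici p) := by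
  obtain ⟨i, hi⟩ := exists_X_notMem p
  obtain ⟨l, hl, hpl⟩ := exists_ltSeries_of_mem_minimalPrimes hr (isHomogeneous_span hS) hp hi
  rw [← Order.coheight_eq_krullDim_Ici]
  have h1 : (l.length : ℕ∞) ≤ Order.coheight p := Order.length_le_coheight hpl
  have h2 : (s : ℕ∞) ≤ Order.coheight p := le_trans (by exact_mod_cast (by omega)) h1
  exact_mod_cast h2

/-- At most `n` forms of positive degree have a common zero in `ℙⁿ`. -/
lemma exists_mem_minimalPrimes {S : Set (MvPolynomial (Fin (n + 1)) k)}
    (hS : ∀ p ∈ S, ∃ d, p.IsHomogeneous d) (hS0 : ∀ p ∈ S, constantCoeff p = 0) {r : ℕ}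
    (hr : S.encard ≤ r) (hrn : r ≤ n) :
    ∃ p : ProjectiveSpectrum (homogeneousSubmodule (Fin (n + 1)) k),
      p.asHomogeneousIdeal.toIdeal ∈ (Ideal.span S).minimalPrimes := by
  have hprime : (RingHom.ker (constantCoeff (R := k) (σ := Fin (n + 1)))).IsPrime :=
    RingHom.ker_isPrime _
  obtain ⟨P, hP, hPm⟩ := Ideal.exists_minimalPrimes_le
    (show Ideal.span S ≤ RingHom.ker (constantCoeff (R := k) (σ := Fin (n + 1))) from
      Ideal.span_le.mpr hS0)
  have hfin : S.Finite := Set.finite_of_encard_le_coe hr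
  have hht : P.height ≤ n := by
    refine (Ideal.height_le_card_of_mem_minimalPrimes_span hfin hP).trans ?_
    rw [hfin.cast_ncard_eq]
    exact hr.trans (by exact_mod_cast hrn)
  -- Otherwise P is the irrelevant ideal, whose height n + 1 is too large for at most n generators.
  obtain ⟨i, hi⟩ : ∃ i, X i ∉ P := by
    by_contra! h
    rw [le_antisymm hPm (ker_constantCoeff_le h), height_ker_constantCoeff] at hht
    exact absurd (by exact_mod_cast hht : n + 1 ≤ n) (by omega)
  exact ⟨pointOfPrime P hP.1.1 ((isHomogeneous_span hS).of_mem_minimalPrimes _ hP) hi, hP⟩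

lemma krullDim_Ici_le {S : Set (MvPolynomial (Fin (n + 1)) k)}
    {p : ProjectiveSpectrum (homogeneousSubmodule (Fin (n + 1)) k)}
    (hp : p.asHomogeneousIdeal.toIdeal ∈ (Ideal.span S).minimalPrimes) :
    Order.krullDim (Set.Ici p) ≤ Order.krullDim
      (ProjectiveSpectrum.zeroLocus (homogeneousSubmodule (Fin (n + 1)) k) S) :=
  Order.krullDim_le_of_strictMono (Set.inclusion fun _ hq =>
    (Ideal.span_le.mp hp.1.2).trans hq) fun _ _ h => h

/-! ### Algebraic extensions of the base field -/

section BaseChange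

variable (k' : Type u) [Field k'] [Algebra k k']

attribute [local instance] algebraMvPolynomial

/-- The map `ℙⁿ_{k'} → ℙⁿ_k` on points. -/
noncomputable def baseChangePoint
    (p : ProjectiveSpectrum (homogeneousSubmodule (Fin (n + 1)) k')) :
    ProjectiveSpectrum (homogeneousSubmodule (Fin (n + 1)) k) where
  asHomogeneousIdeal := p.asHomogeneousIdeal.comap
    ({ map (algebraMap k k') with map_mem := fun h => IsHomogeneous.map h _ } :
      homogeneousSubmodule (Fin (n + 1)) k →+*ᵍ homogeneousSubmodule (Fin (n + 1)) k')
  isPrime := p.isPrime.comap (map (algebraMap k k'))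
  not_irrelevant_le h := by
    obtain ⟨i, hi⟩ := exists_X_notMem p
    have : map (algebraMap k k') (X i) ∈ p.asHomogeneousIdeal.toIdeal :=
      h (HomogeneousIdeal.mem_irrelevant_of_mem _ one_pos (isHomogeneous_X k i))
    rw [map_X] at this
    exact hi this

/-- Incomparability: distinct nested primes of an integral extension have distinct contractions. -/
lemma baseChangePoint_strictMono [Algebra.IsIntegral k k'] :
    StrictMono (baseChangePoint (n := n) (k := k) k') := by
  intro p q hpq
  have hp := p.isPrime
  have hpq' : p.asHomogeneousIdeal.toIdeal < q.asHomogeneousIdeal.toIdeal := hpq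
  exact Ideal.IsIntegral.comap_lt_comap (R := MvPolynomial (Fin (n + 1)) k) hpq'

/-- Dimensions of closed subsets do not grow under algebraic extensions of the base field. -/
lemma krullDim_zeroLocus_image_map_le [Algebra.IsIntegral k k']
    (T : Set (MvPolynomial (Fin (n + 1)) k)) :
    Order.krullDim (ProjectiveSpectrum.zeroLocus (homogeneousSubmodule (Fin (n + 1)) k')
      (map (algebraMap k k') '' T)) ≤
    Order.krullDim (ProjectiveSpectrum.zeroLocus (homogeneousSubmodule (Fin (n + 1)) k) T) :=
  Order.krullDim_le_of_strictMono
    (fun p => ⟨baseChangePoint k' p.1, fun t ht => p.2 ⟨t, ht, rfl⟩⟩)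
    fun _ _ hpq => baseChangePoint_strictMono k' hpq

end BaseChange

/-- Forms in the span of the partial derivatives over a finite extension such that each of them
cuts down the dimension outside of the singular locus. -/
theorem exists_finiteDimensional_forms {f : MvPolynomial (Fin (n + 1)) k}
    (hd : ∃ i, pderiv i f ≠ 0) (r : ℕ) :
    ∃ (k' : Type u) (_ : Field k') (_ : Algebra k k') (_ : FiniteDimensional k k')
      (g : Fin r → MvPolynomial (Fin (n + 1)) k'),
      (∀ j, g j ∈ Submodule.span k' (Set.range fun i => pderiv i (map (algebraMap k k') f))) ∧
      (∀ j, g j ≠ 0) ∧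
      ∀ P : Ideal (MvPolynomial (Fin (n + 1)) k'), P.IsPrime →
        insert (map (algebraMap k k') f) (Set.range g) ⊆ (P : Set (MvPolynomial (Fin (n + 1)) k')) →
        (∀ i, pderiv i (map (algebraMap k k') f) ∈ P) ∨ (r + 1 : ℕ) ≤ P.height := by
  let K := AlgebraicClosure k
  have hinj : ∀ (E F : Type u) [Field E] [Field F] [Algebra E F],
      Function.Injective (map (algebraMap E F) : MvPolynomial (Fin (n + 1)) E →+* _) :=
    fun E F _ _ _ => map_injective _ (algebraMap E F).injective
  set W := Submodule.span K (Set.range fun i => pderiv i (map (algebraMap k K) f))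
  have hpW : ∀ i, pderiv i (map (algebraMap k K) f) ∈ W := fun i => Submodule.subset_span ⟨i, rfl⟩
  have hW : W ≠ ⊥ := by
    obtain ⟨i, hi⟩ := hd
    intro h
    have := hpW i
    rw [h, Submodule.mem_bot, pderiv_map] at this
    exact hi (hinj k K (this.trans (map_zero _).symm))
  have hf0 : map (algebraMap k K) f ≠ 0 := by
    obtain ⟨i, hi⟩ := hd
    refine fun h => hi ?_
    rw [hinj k K (h.trans (map_zero _).symm), map_zero]
  obtain ⟨g, hgW, hg0, hg⟩ := exists_forall_le_or_le_height hW hf0 r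
  choose c hc using fun j => (Submodule.mem_span_range_iff_exists_fun K).mp (hgW j)
  -- Generated by finitely many algebraic elements, the coefficients of the g_j in terms of the
  -- partial derivatives.
  let E := IntermediateField.adjoin k (Set.range fun x : Fin r × Fin (n + 1) => c x.1 x.2)
  have hcE : ∀ j i, c j i ∈ E := fun j i => IntermediateField.subset_adjoin k _ ⟨(j, i), rfl⟩
  have hE : FiniteDimensional k E := IntermediateField.finiteDimensional_adjoin fun x _ =>
    Algebra.IsIntegral.isIntegral x
  let g' : Fin r → MvPolynomial (Fin (n + 1)) E := fun j =>
    ∑ i, (⟨c j i, hcE j i⟩ : E) • pderiv i (map (algebraMap k E) f)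
  have hmapf : map (algebraMap E K) (map (algebraMap k E) f) = map (algebraMap k K) f := by
    rw [map_map, ← IsScalarTower.algebraMap_eq]
  have hg' : ∀ j, map (algebraMap E K) (g' j) = g j := fun j => by
    rw [← hc j, map_sum]
    refine Finset.sum_congr rfl fun i _ => ?_
    rw [smul_eq_C_mul, map_mul, map_C, ← pderiv_map, hmapf, smul_eq_C_mul]
    rfl
  refine ⟨E, inferInstance, inferInstance, hE, g', fun j => ?_, fun j h => ?_, fun P hP hgP => ?_⟩
  · exact Submodule.sum_mem _ fun i _ => Submodule.smul_mem _ _ (Submodule.subset_span ⟨i, rfl⟩)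
  · exact hg0 j (by rw [← hg' j, h, map_zero])
  · let := algebraMvPolynomial (R := E) (S := K) (σ := Fin (n + 1))
    -- Lying over: the dichotomy holds for a prime Q over K above P, and the height of P is at least
    -- that of Q.
    obtain ⟨Q, -, hQ, hQP⟩ := Ideal.exists_ideal_over_prime_of_isIntegral P
      (⊥ : Ideal (MvPolynomial (Fin (n + 1)) K)) (by
        refine le_trans (le_of_eq ?_) bot_le
        exact (RingHom.injective_iff_ker_eq_bot _).mp (hinj E K))
    have hmem : ∀ a, a ∈ P ↔ map (algebraMap E K) a ∈ Q := fun a => by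
      rw [← hQP]
      rfl
    refine (hg Q hQ ?_).imp (fun h i => ?_) fun h => ?_
    · refine Set.insert_subset ?_ ?_
      · rw [← hmapf]
        exact (hmem _).mp (hgP (Set.mem_insert _ _))
      · rintro _ ⟨j, rfl⟩
        rw [← hg' j]
        exact (hmem _).mp (hgP (Set.mem_insert_of_mem _ ⟨j, rfl⟩))
    · rw [hmem, ← pderiv_map, hmapf]
      exact h (hpW i)
    · rw [← hQP]
      exact h.trans (Ideal.height_le_height_comap_of_isIntegral Q)

end ProjHypersurface

/-! ### The singular locus of the hypersurface and the theorem -/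

namespace ProjHypersurface

attribute [local instance] MvPolynomial.gradedAlgebra

open MvPolynomial

variable {n : ℕ} {k : Type u} [Field k]

/-- Jacobian criterion: the common zeros of a form and its partial derivatives are singular points. -/
lemma krullDim_zeroLocus_le_singularLocus [PerfectField k] {f : MvPolynomial (Fin (n + 1)) k} {δ : ℕ}
    (hf : f.IsHomogeneous δ) (hf0 : f ≠ 0) :
    Order.krullDim (ProjectiveSpectrum.zeroLocus (homogeneousSubmodule (Fin (n + 1)) k)
      (insert f (Set.range fun i => pderiv i f))) ≤
    topologicalKrullDim (singularLocus (V {f})) := by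
  have hS : ∀ g ∈ ({f} : Set (MvPolynomial (Fin (n + 1)) k)), ∃ d, g.IsHomogeneous d := by
    rintro _ rfl
    exact ⟨δ, hf⟩
  refine le_trans ?_ (krullDim_image_le_topologicalKrullDim (Y := V {f})
    (toAmbient (homogeneousSubmodule (Fin (n + 1)) k) (homogeneousIdeal {f}))
    (specializes_iff_toAmbient_le _ _) (singularLocus (V {f})))
  have hsub : ProjectiveSpectrum.zeroLocus (homogeneousSubmodule (Fin (n + 1)) k)
      (insert f (Set.range fun i => pderiv i f)) ⊆
      toAmbient (homogeneousSubmodule (Fin (n + 1)) k) (homogeneousIdeal {f}) ''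
        singularLocus (V {f}) := by
    intro p hp
    have : p ∈ Set.range (toAmbient (homogeneousSubmodule (Fin (n + 1)) k) (homogeneousIdeal {f})) := by
      rw [range_toAmbient, zeroLocus_homogeneousIdeal hS]
      exact Set.singleton_subset_iff.mpr (hp (Set.mem_insert _ _))
    obtain ⟨x, rfl⟩ := this
    exact ⟨x, mem_singularLocus hf hf0 x fun i => hp (Set.mem_insert_of_mem _ ⟨i, rfl⟩), rfl⟩
  exact Order.krullDim_le_of_strictMono (Set.inclusion hsub) fun _ _ h => h

lemma constantCoeff_eq_zero_of_isHomogeneous {f : MvPolynomial (Fin (n + 1)) k} {δ : ℕ}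
    (hf : f.IsHomogeneous δ) (hδ : δ ≠ 0) : constantCoeff f = 0 := by
  by_contra h
  have := hf h
  rw [map_zero] at this
  exact hδ this.symm

/-- If the singular locus has codimension at least two, then some partial derivative is non-zero. -/
lemma exists_pderiv_ne_zero [PerfectField k] {s : ℕ} (hs : s + 2 ≤ n)
    {f : MvPolynomial (Fin (n + 1)) k} {δ : ℕ} (hf : f.IsHomogeneous δ) (hf0 : f ≠ 0) (hδ : δ ≠ 0)
    (hsing : topologicalKrullDim (singularLocus (V {f})) = (s : WithBot ℕ∞)) :
    ∃ i, pderiv i f ≠ 0 := by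
  by_contra! h
  have hS : ∀ g ∈ ({f} : Set (MvPolynomial (Fin (n + 1)) k)), ∃ d, g.IsHomogeneous d := by
    rintro _ rfl
    exact ⟨δ, hf⟩
  have hS0 : ∀ g ∈ ({f} : Set (MvPolynomial (Fin (n + 1)) k)), constantCoeff g = 0 := by
    rintro _ rfl
    exact constantCoeff_eq_zero_of_isHomogeneous hf hδ
  have hcard : ({f} : Set (MvPolynomial (Fin (n + 1)) k)).encard ≤ (1 : ℕ) := by simp
  obtain ⟨p, hp⟩ := exists_mem_minimalPrimes hS hS0 hcard (by omega)
  -- V(f) has dimension at least n - 1; if all partial derivatives vanished, it would consist of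
  -- singular points, forcing n - 1 ≤ s.
  have h1 := (le_krullDim_Ici hS hcard (show (n - 1) + 1 ≤ n by omega) hp).trans (krullDim_Ici_le hp)
  have h2 := krullDim_zeroLocus_le_singularLocus hf hf0
  have h3 : ProjectiveSpectrum.zeroLocus (homogeneousSubmodule (Fin (n + 1)) k)
      (insert f (Set.range fun i => pderiv i f)) =
      ProjectiveSpectrum.zeroLocus (homogeneousSubmodule (Fin (n + 1)) k) {f} := by
    ext p
    simp only [ProjectiveSpectrum.mem_zeroLocus, h, Set.insert_subset_iff, Set.range_subset_iff,
      Set.singleton_subset_iff]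
    exact and_iff_left fun _ => zero_mem p.asHomogeneousIdeal
  rw [h3, hsing] at h2
  have : n - 1 ≤ s := by exact_mod_cast h1.trans h2
  omega

end ProjHypersurface

/-- The scheme `V(f)_{k'} ∩ V(g₁) ∩ … ∩ V(g_{n-s-1})` has dimension `s`, and it is a complete
intersection: it is cut out by `n - s` hypersurfaces of `ℙⁿ` over `k'`, and all its irreducible
components have the expected dimension `n - (n - s) = s`. -/
theorem mainTheorem8 {k : Type u} [Field k] [PerfectField k] (n s : ℕ) (hs : s + 2 ≤ n)
    (δ : ℕ) (f : MvPolynomial (Fin (n + 1)) k) (hf : f.IsHomogeneous δ) (hf0 : f ≠ 0)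
    (hsing : topologicalKrullDim
      (ProjHypersurface.singularLocus (ProjHypersurface.V {f})) = (s : WithBot ℕ∞)) :
    ∃ (k' : Type u) (_ : Field k') (_ : Algebra k k') (_ : FiniteDimensional k k')
      (g : Fin (n - s - 1) → MvPolynomial (Fin (n + 1)) k'),
      (∀ i, g i ∈ ProjHypersurface.derivSpaceBaseChange k' 1 f) ∧
      (∀ i, g i ≠ 0) ∧
      topologicalKrullDim (ProjHypersurface.V
        (insert (MvPolynomial.map (algebraMap k k') f) (Set.range g))) = (s : WithBot ℕ∞) ∧
      ∀ Z ∈ irreducibleComponents (ProjHypersurface.V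
        (insert (MvPolynomial.map (algebraMap k k') f) (Set.range g))),
        topologicalKrullDim Z = (s : WithBot ℕ∞) := by
  classical
  -- The empty space has dimension `⊥`, which is not a natural number.
  obtain ⟨x, hx⟩ : (ProjHypersurface.singularLocus (ProjHypersurface.V {f})).Nonempty := by
    by_contra h
    have : IsEmpty (ProjHypersurface.singularLocus (ProjHypersurface.V {f})) :=
      Set.isEmpty_coe_sort.mpr (Set.not_nonempty_iff_eq_empty.mp h)
    have : IsEmpty (TopologicalSpace.IrreducibleCloseds
        (ProjHypersurface.singularLocus (ProjHypersurface.V {f}))) :=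
      ⟨fun Z => isEmptyElim Z.isIrreducible.nonempty.some⟩
    rw [topologicalKrullDim, Order.krullDim_eq_bot] at hsing
    exact WithBot.bot_ne_coe hsing
  have hδ := ProjHypersurface.two_le_of_mem_singularLocus hf hf0 hx
  have hd := ProjHypersurface.exists_pderiv_ne_zero hs hf hf0 (by omega) hsing
  obtain ⟨k', _, _, hfin, g, hgW, hg0, hg⟩ :=
    ProjHypersurface.exists_finiteDimensional_forms hd (n - s - 1)
  set f' := MvPolynomial.map (algebraMap k k') f
  have hf'hom : f'.IsHomogeneous δ := hf.map _
  have hghom : ∀ j, (g j).IsHomogeneous (δ - 1) := fun j => by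
    refine (Submodule.span_le (p := MvPolynomial.homogeneousSubmodule (Fin (n + 1)) k' (δ - 1))).mpr
      ?_ (hgW j)
    rintro _ ⟨i, rfl⟩
    exact hf'hom.pderiv
  have hS : ∀ p ∈ insert f' (Set.range g), ∃ d, d ≠ 0 ∧ p.IsHomogeneous d := by
    rintro p (rfl | ⟨j, rfl⟩)
    · exact ⟨δ, by omega, hf'hom⟩
    · exact ⟨δ - 1, by omega, hghom j⟩
  have hShom : ∀ p ∈ insert f' (Set.range g), ∃ d, p.IsHomogeneous d := fun p hp =>
    (hS p hp).imp fun _ h => h.2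
  -- Only an inequality, since the g_j may repeat; Krull's theorem needs no more.
  have hcard : (insert f' (Set.range g)).encard ≤ (n - s : ℕ) := by
    refine (Set.encard_insert_le _ _).trans ?_
    have : (Set.range g).encard ≤ (n - s - 1 : ℕ) := by
      rw [← Set.image_univ]
      exact Set.encard_image_le _ _ |>.trans (by simp)
    refine (add_le_add_left this 1).trans ?_
    exact_mod_cast (by omega : n - s - 1 + 1 ≤ n - s)
  have hle : topologicalKrullDim (ProjHypersurface.V (insert f' (Set.range g))) ≤ s := by
    rw [ProjHypersurface.topologicalKrullDim_V hShom]
    -- T is the base change of the common zero locus of f and its partial derivatives, whose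
    -- dimension over k is at most s by the Jacobian criterion.
    refine ProjHypersurface.krullDim_zeroLocus_le (r := n - s - 1 + 1)
      (T := MvPolynomial.map (algebraMap k k') '' insert f (Set.range fun i => MvPolynomial.pderiv i f))
      (by omega) (fun P hP hSP => (hg P hP hSP).imp_left fun h => ?_) ?_
    · rintro _ ⟨a, rfl | ⟨i, rfl⟩, rfl⟩
      · exact hSP (Set.mem_insert _ _)
      · change MvPolynomial.map _ (MvPolynomial.pderiv i f) ∈ P
        rw [← MvPolynomial.pderiv_map]
        exact h i
    · refine (ProjHypersurface.krullDim_zeroLocus_image_map_le k' _).trans ?_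
      exact (ProjHypersurface.krullDim_zeroLocus_le_singularLocus hf hf0).trans hsing.le
  refine ⟨k', inferInstance, inferInstance, hfin, g, fun j => ?_, hg0, le_antisymm hle ?_,
    fun Z hZ => le_antisymm ((topologicalKrullDim_subspace_le _ Z).trans hle) ?_⟩
  · rw [ProjHypersurface.derivSpaceBaseChange_one]
    exact hgW j
  · obtain ⟨p, hp⟩ := ProjHypersurface.exists_mem_minimalPrimes hShom (fun p hp =>
      (hS p hp).elim fun _ h => ProjHypersurface.constantCoeff_eq_zero_of_isHomogeneous h.2 h.1)
      hcard (by omega)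
    rw [ProjHypersurface.topologicalKrullDim_V hShom]
    exact (ProjHypersurface.le_krullDim_Ici hShom hcard (by omega) hp).trans
      (ProjHypersurface.krullDim_Ici_le hp)
  · obtain ⟨p, hp, hpZ⟩ :=
      ProjHypersurface.exists_minimalPrimes_of_mem_irreducibleComponents hShom hZ
    exact (ProjHypersurface.le_krullDim_Ici hShom hcard (by omega) hp).trans hpZ
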